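/- **Setting.** Let $G$ be a compact, connected Lie group with Lie algebra $\mathfrak g$ and normalized Haar measure $\mu$, let $\phi:G\to\mathcal U(V)$ be a (smooth) unitary representation on a finite-dimensional complex Hilbert space $V$, with differential $d\phi:\mathfrak g\to\mathfrak u(V)$, and write $\mathbf U_g=\phi(g)$. Let $\mathfrak g_\alpha$ run over the simple ideals of $\mathfrak g$ and $d_{\mathfrak g_\alpha}=\dim\mathfrak g_\alpha$. The space $\mathfrak u(V)$ of skew-Hermitian operators carries the Frobenius inner product $\langle X,Y\rangle=-\mathrm{Tr}(XY)$ and the orthogonal representation of $G$ by conjugation, $X\mapsto \mathbf U_gX\mathbf U_g^\dagger$. Fix an orthogonal decomposition $d\phi(\mathfrak g)^{\perp}=\bigoplus_\kappa W_\kappa$ into irreducible real subrepresentations, and put $W_\alpha=d\phi(\mathfrak g_\alpha)$. Write $\kappa\cong\alpha$ (resp. $\kappa\cong\kappa'$) if $W_\kappa$ is $G$-isomorphic to $W_\alpha$ (resp. $W_{\kappa'}$). For a Hermitian operator $\mathbf A$ let $i\mathbf A_{j}$ be the orthogonal projection of $i\mathbf A$ onto $W_j$; we also write $\mathbf A_{\mathfrak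 g_\alpha}$ for $\mathbf A_\alpha$. For $h\in\mathfrak g$ put $\mathbf H=d\phi(h)$, let $\mathbf H_{\mathfrak g_\alpha}$ be the orthogonal projection of $\mathbf H$ onto $d\phi(\mathfrak g_\alpha)$, and $\|\mathbf H_{\mathfrak g_\alpha}\|_{\mathrm K}^2=-B_\alpha(a,a)$, where $a\in\mathfrak g_\alpha$, $d\phi(a)=\mathbf H_{\mathfrak g_\alpha}$ and $B_\alpha$ is the Killing form of $\mathfrak g_\alpha$ (if $d\phi$ vanishes on $\mathfrak g_\alpha$, the choice of $a$ is immaterial below). For two $G$-isomorphic components $W_1,W_2$, a $G$-isomorphism $\gamma:W_2\to W_1$ (extended complex-linearly), orthonormal bases $\{u_j\}$ of $W_1$ and $\{v_k\}$ of $W_2$, orthogonal projectors $P_1,P_2$ onto $W_1,W_2$, and Hermitian $\mathbf A,\mathbf B,\mathbf C$ define $$(\mathbf B,\mathbf C)_{1,2}=\mathrm{Tr}(\mathbf B_1\,\gamma\mathbf B_2)\,\mathrm{Tr}(\mathbf C_1(\gamma^{-1})^\dagger\mathbf C_2),\qquad (\mathbf A)_{1,2}=\sum_{j,k}-\langle u_j,(\gamma^{-1})^\dagger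 v_k\rangle\,\mathrm{Tr}\big(P_1([i\mathbf A,u_j])\,\gamma P_2([i\mathbf A,v_k])\big).$$ Let $\mathbf O$ be an arbitrary observable (Hermitian operator on $V$), $\rho$ a density operator on $V$, $h\in\mathfrak g$, and $$\mathrm{GradVar}=\mathrm{Var}_{(g^+,g^-)\sim\mu^{\otimes2}}\Big[\mathrm{Tr}\big\{\mathbf U_{g^-}^\dagger\rho\,\mathbf U_{g^-}[\mathbf H,\mathbf U_{g^+}\mathbf O\mathbf U_{g^+}^\dagger]\big\}\Big].$$ **Theorem (Lower bound by DLA component).** For every $\alpha$, all the components in $\{W_\alpha\}\cup\{W_\kappa:\kappa\cong\alpha\}$ are $G$-isomorphic to each other, and for any two of them the quantities $(\mathbf B,\mathbf C)_{1,2}$ and $(\mathbf A)_{1,2}$ do not depend on $\gamma$ and the orthonormal bases. Moreover $$\mathrm{GradVar}\;\ge\;\sum_\alpha\frac1{d_{\mathfrak g_\alpha}^2}\Big(\|\mathbf H_{\mathfrak g_\alpha}\|_{\mathrm K}^2\|\mathbf O_{\mathfrak g_\alpha}\|_{\mathrm F}^2\|\rho_{\mathfrak g_\alpha}\|_{\mathrm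 F}^2+\sum_{\kappa\cong\alpha}\Big(\|\mathbf O_\kappa\|_{\mathrm F}^2\|\rho_\kappa\|_{\mathrm F}^2(i\mathbf H)_{\kappa,\kappa}+\sum_{\kappa'\cong\kappa,\ \kappa'\ne\kappa}(\mathbf O,\rho)_{\kappa,\kappa'}(i\mathbf H)_{\kappa,\kappa'}+2\,(\mathbf O,\rho)_{\kappa,\alpha}(i\mathbf H)_{\kappa,\alpha}\Big)\Big),$$ where $\alpha$ indexes the simple ideals and $\kappa,\kappa'$ index components of the complement. -/

import Mathlib

open MeasureTheory ProbabilityTheory Module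
open scoped Manifold ContDiff InnerProductSpace

noncomputable section

namespace DLA

set_option linter.unusedSectionVars false

/-! ### Skew-Hermitian operators with the Frobenius inner product -/

section Operators

variable (V : Type*) [NormedAddCommGroup V] [InnerProductSpace ℂ V] [FiniteDimensional ℂ V]

/-- Observables: Hermitian operators on the finite-dimensional Hilbert space `V`. -/
abbrev Observable : Type _ := selfAdjoint (V →L[ℂ] V)

/-- `𝔲(V)`: the real vector space of skew-Hermitian operators on `V`.  (A plain `def`, so that it
carries the Frobenius norm below and not the operator norm.) -/
def SkewOp : Type _ := skewAdjoint.submodule ℝ (V →L[ℂ] V)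

instance : AddCommGroup (SkewOp V) :=
  inferInstanceAs (AddCommGroup (skewAdjoint.submodule ℝ (V →L[ℂ] V)))

instance : Module ℝ (SkewOp V) :=
  inferInstanceAs (Module ℝ (skewAdjoint.submodule ℝ (V →L[ℂ] V)))

instance : FiniteDimensional ℝ (V →L[ℂ] V) :=
  have : FiniteDimensional ℂ (V →L[ℂ] V) :=
    LinearEquiv.finiteDimensional (LinearMap.toContinuousLinearMap (𝕜 := ℂ) (E := V) (F' := V))
  Module.Finite.trans ℂ _

instance : FiniteDimensional ℝ (SkewOp V) :=
  inferInstanceAs (FiniteDimensional ℝ (skewAdjoint.submodule ℝ (V →L[ℂ] V)))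

variable {V}

/-- The trace of an operator. -/
def tr (A : V →L[ℂ] V) : ℂ := LinearMap.trace ℂ V (A : V →ₗ[ℂ] V)

theorem tr_mul_comm (A B : V →L[ℂ] V) : tr (A * B) = tr (B * A) :=
  LinearMap.trace_mul_comm ℂ (A : V →ₗ[ℂ] V) (B : V →ₗ[ℂ] V)

theorem tr_add (A B : V →L[ℂ] V) : tr (A + B) = tr A + tr B := by
  simp [tr]

theorem tr_sub (A B : V →L[ℂ] V) : tr (A - B) = tr A - tr B := by
  simp [tr]

theorem tr_neg (A : V →L[ℂ] V) : tr (-A) = -tr A := by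
  simp [tr]

theorem tr_real_smul (r : ℝ) (A : V →L[ℂ] V) : tr (r • A) = r * tr A := by
  have : r • A = (r : ℂ) • A := by ext; simp
  rw [this]
  simp [tr]

theorem tr_eq_sum (A : V →L[ℂ] V) :
    tr A = ∑ i, ⟪stdOrthonormalBasis ℂ V i, A (stdOrthonormalBasis ℂ V i)⟫_ℂ :=
  LinearMap.trace_eq_sum_inner _ _

theorem tr_star (A : V →L[ℂ] V) : tr (star A) = star (tr A) := by
  simp only [tr_eq_sum, ContinuousLinearMap.star_eq_adjoint,
    ContinuousLinearMap.adjoint_inner_right, star_sum]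
  refine Finset.sum_congr rfl fun i _ => ?_
  exact (inner_conj_symm _ _).symm

theorem re_tr_star_mul_self (A : V →L[ℂ] V) :
    (tr (star A * A)).re = ∑ i, ‖A (stdOrthonormalBasis ℂ V i)‖ ^ 2 := by
  simp only [tr_eq_sum, ContinuousLinearMap.star_eq_adjoint, mul_apply_eq_comp,
    ContinuousLinearMap.adjoint_inner_right, Complex.re_sum]
  refine Finset.sum_congr rfl fun i _ => ?_
  exact inner_self_eq_norm_sq (𝕜 := ℂ) _

namespace SkewOp

/-- The underlying operator of an element of `𝔲(V)`. -/
def op : SkewOp V →ₗ[ℝ] (V →L[ℂ] V) := (skewAdjoint.submodule ℝ (V →L[ℂ] V)).subtype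

theorem star_op (X : SkewOp V) : star (op X) = -op X := X.2

theorem op_injective : Function.Injective (op : SkewOp V →ₗ[ℝ] (V →L[ℂ] V)) :=
  Subtype.val_injective

/-- A skew-Hermitian operator as an element of `𝔲(V)`. -/
def mk (A : V →L[ℂ] V) (hA : star A = -A) : SkewOp V := ⟨A, hA⟩

@[simp] theorem op_mk (A : V →L[ℂ] V) (hA : star A = -A) : op (mk A hA) = A := rfl

/-- The Frobenius inner product `⟨X, Y⟩ = Tr (X† Y) = -Tr (X Y)` (a real number) on `𝔲(V)`. -/
@[reducible] def frobeniusCore : InnerProductSpace.Core ℝ (SkewOp V) where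
  inner X Y := -(tr (op X * op Y)).re
  conj_inner_symm X Y := by
    simp [tr_mul_comm (op X) (op Y)]
  re_inner_nonneg X := by
    have h := re_tr_star_mul_self (op X)
    rw [star_op, neg_mul, tr_neg, Complex.neg_re] at h
    simp only [RCLike.re_to_real, h]
    positivity
  add_left X Y Z := by
    simp only [map_add, add_mul, tr_add, Complex.add_re]; ring
  smul_left X Y r := by
    simp [tr_real_smul]
  definite X hX := by
    have h := re_tr_star_mul_self (op X)
    rw [star_op, neg_mul, tr_neg, Complex.neg_re, hX, eq_comm,
      Finset.sum_eq_zero_iff_of_nonneg (fun _ _ => by positivity)] at h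
    apply op_injective
    rw [map_zero]
    have h2 : ((op X : V →L[ℂ] V) : V →ₗ[ℂ] V) = 0 :=
      (stdOrthonormalBasis ℂ V).toBasis.ext fun i => by simpa using h i (Finset.mem_univ i)
    ext v
    exact LinearMap.congr_fun h2 v

instance : NormedAddCommGroup (SkewOp V) := frobeniusCore.toNormedAddCommGroup

instance : InnerProductSpace ℝ (SkewOp V) := InnerProductSpace.ofCore frobeniusCore.toCore

theorem inner_def (X Y : SkewOp V) : ⟪X, Y⟫_ℝ = -(tr (op X * op Y)).re := rfl

/-- The commutator `[X, Y] = X Y - Y X` on `𝔲(V)`. -/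
instance : Bracket (SkewOp V) (SkewOp V) where
  bracket X Y := mk (op X * op Y - op Y * op X) (by
    simp only [star_sub, star_mul, star_op]; noncomm_ring)

/-- The conjugation `X ↦ U X U†` by a unitary operator `U`. -/
def conj (U : unitary (V →L[ℂ] V)) : SkewOp V →ₗ[ℝ] SkewOp V where
  toFun X := mk ((U : V →L[ℂ] V) * op X * star (U : V →L[ℂ] V)) (by
    simp [star_mul, star_op, mul_assoc])
  map_add' X Y := op_injective (by simp [mul_add, add_mul])
  map_smul' r X := op_injective (by simp)

/-- The skew-Hermitian operator `i A` of an observable `A`. -/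
def ofObs (A : Observable V) : SkewOp V := mk (Complex.I • (A : V →L[ℂ] V)) (by
  rw [star_smul, selfAdjoint.mem_iff.mp A.2]; simp)

/-- The Hermitian operator `i X` of a skew-Hermitian operator `X`. -/
def toObs (X : SkewOp V) : Observable V := ⟨Complex.I • op X, by
  rw [selfAdjoint.mem_iff, star_smul, star_op]; simp⟩

end SkewOp

/-- Density operators: positive semidefinite operators of trace one. -/
def IsDensityOperator (ρ : Observable V) : Prop :=
  (ρ : V →L[ℂ] V).IsPositive ∧ tr (ρ : V →L[ℂ] V) = 1

end Operators

/-! ### Simple ideals of a finite-dimensional real Lie algebra -/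

section SimpleIdeals

variable (L : Type*) [LieRing L] [LieAlgebra ℝ L]

/-- The simple ideals of a real Lie algebra. -/
abbrev SimpleIdeal : Type _ := {I : LieIdeal ℝ L // LieAlgebra.IsSimple ℝ I}

variable {L}

theorem SimpleIdeal.inf_eq {I J : LieIdeal ℝ L} (hI : LieAlgebra.IsSimple ℝ I) :
    I ⊓ J = ⊥ ∨ I ≤ J := by
  rcases hI.eq_bot_or_eq_top (J.comap I.incl) with h | h
  · left
    rw [LieSubmodule.eq_bot_iff]
    rintro x ⟨hxI, hxJ⟩
    have : (⟨x, hxI⟩ : I) ∈ J.comap I.incl := by simpa using hxJ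
    rw [h, LieSubmodule.mem_bot] at this
    exact congrArg Subtype.val this
  · right
    intro x hx
    have : (⟨x, hx⟩ : I) ∈ J.comap I.incl := by rw [h]; trivial
    simpa using this

theorem SimpleIdeal.sSupIndep :
    _root_.sSupIndep {I : LieIdeal ℝ L | LieAlgebra.IsSimple ℝ I} := by
  intro I hI
  have hI' : LieAlgebra.IsSimple ℝ I := hI
  rw [disjoint_iff]
  refine (SimpleIdeal.inf_eq hI').resolve_right fun hle => hI'.non_abelian ?_
  have hcomm : (sSup ({I : LieIdeal ℝ L | LieAlgebra.IsSimple ℝ I} \ {I}) : LieIdeal ℝ L).toSubmodule ≤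
      (LieModule.maxTrivSubmodule ℝ I L).toSubmodule := by
    rw [sSup_eq_iSup', LieSubmodule.iSup_toSubmodule, iSup_le_iff]
    rintro ⟨J, hJ, hne⟩ y hy
    have hJ' : LieAlgebra.IsSimple ℝ J := hJ
    have hinf : I ⊓ J = ⊥ := by
      rcases SimpleIdeal.inf_eq (J := J) hI' with h | h
      · exact h
      · rcases SimpleIdeal.inf_eq (J := I) hJ' with h2 | h2
        · rw [inf_comm]; exact h2
        · exact absurd (le_antisymm h2 h) hne
    refine (LieModule.mem_maxTrivSubmodule ℝ I L y).mpr fun x => ?_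
    have hmem : ⁅(x : L), y⁆ ∈ I ⊓ J := ⟨lie_mem_left ℝ L I x y x.2, J.lie_mem hy⟩
    rw [hinf] at hmem
    exact (LieSubmodule.mem_bot _).mp hmem
  refine ⟨fun x y => ?_⟩
  apply Subtype.ext
  exact (LieModule.mem_maxTrivSubmodule ℝ I L (y : L)).mp (hcomm (hle y.2)) x

instance [FiniteDimensional ℝ L] : Finite (SimpleIdeal L) :=
  WellFoundedGT.finite_of_sSupIndep (SimpleIdeal.sSupIndep (L := L))

instance [FiniteDimensional ℝ L] : Fintype (SimpleIdeal L) := Fintype.ofFinite _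

/-- The dimension of a simple ideal. -/
def SimpleIdeal.dim (α : SimpleIdeal L) : ℕ := finrank ℝ α.1

end SimpleIdeals

/-! ### Unitary representations of a Lie group -/

instance : ENat.LEInfty (minSmoothness ℝ 3) := ⟨by
  rw [minSmoothness_of_isRCLikeNormedField]; exact ENat.LEInfty.out⟩

section Representations

variable {E : Type*} [NormedAddCommGroup E] [NormedSpace ℝ E] [FiniteDimensional ℝ E]
  {G : Type*} [TopologicalSpace G] [ChartedSpace E G] [Group G] [LieGroup 𝓘(ℝ, E) ∞ G]
  {V : Type*} [NormedAddCommGroup V] [InnerProductSpace ℂ V] [FiniteDimensional ℂ V]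

instance : FiniteDimensional ℝ (GroupLieAlgebra 𝓘(ℝ, E) G) :=
  inferInstanceAs (FiniteDimensional ℝ E)

variable (E G V) in
/-- A (smooth) unitary representation of the Lie group `G`, modelled on `E`, on the
finite-dimensional Hilbert space `V`. -/
structure UnitaryRep where
  toHom : G →* unitary (V →L[ℂ] V)
  smooth : ContMDiff 𝓘(ℝ, E) 𝓘(ℝ, V →L[ℂ] V) ∞ fun g => (toHom g : V →L[ℂ] V)

namespace UnitaryRep

variable (φ : UnitaryRep E G V)

/-- The operator `U_g = φ(g)`. -/
def U (g : G) : V →L[ℂ] V := φ.toHom g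

/-- The derivative of `g ↦ U_g` at the identity, as a map into the operators on `V`. -/
def dU : GroupLieAlgebra 𝓘(ℝ, E) G →L[ℝ] (V →L[ℂ] V) :=
  mfderiv 𝓘(ℝ, E) 𝓘(ℝ, V →L[ℂ] V) φ.U 1

theorem star_dU (x : GroupLieAlgebra 𝓘(ℝ, E) G) : star (φ.dU x) = -φ.dU x := by
  have hF : MDifferentiableAt 𝓘(ℝ, E) 𝓘(ℝ, V →L[ℂ] V) φ.U 1 :=
    (φ.smooth 1).mdifferentiableAt (by simp)
  have hS := ((starL' ℝ : (V →L[ℂ] V) ≃L[ℝ] (V →L[ℂ] V)) :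
    (V →L[ℂ] V) →L[ℝ] (V →L[ℂ] V)).hasMFDerivAt (x := φ.U 1)
  have hSF := hS.comp (1 : G) hF.hasMFDerivAt
  have hP := hF.hasMFDerivAt.mul' hSF
  have hconst : (φ.U * ((starL' ℝ : (V →L[ℂ] V) ≃L[ℝ] (V →L[ℂ] V)) ∘ φ.U)) =
      fun _ : G => (1 : V →L[ℂ] V) := by
    funext g
    exact Unitary.mul_star_self_of_mem (φ.toHom g).2
  have hP' : HasMFDerivAt 𝓘(ℝ, E) 𝓘(ℝ, V →L[ℂ] V)
      (φ.U * ((starL' ℝ : (V →L[ℂ] V) ≃L[ℝ] (V →L[ℂ] V)) ∘ φ.U)) (1 : G) 0 := by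
    rw [hconst]; exact hasMFDerivAt_const _ _
  have h1 : φ.U 1 = 1 := by simp [U]
  have key := DFunLike.congr_fun (hasMFDerivAt_unique hP hP') x
  have key' : φ.U 1 * star (φ.dU x) + φ.dU x * star (φ.U 1) = 0 := key
  rw [h1, star_one, one_mul, mul_one] at key'
  exact eq_neg_of_add_eq_zero_left key'

/-- The differential `dφ : 𝔤 → 𝔲(V)` of the representation at the identity. -/
def dφ : GroupLieAlgebra 𝓘(ℝ, E) G →ₗ[ℝ] SkewOp V where
  toFun x := SkewOp.mk (φ.dU x) (φ.star_dU x)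
  map_add' x y := SkewOp.op_injective (by
    simp only [SkewOp.op_mk, map_add])
  map_smul' r x := SkewOp.op_injective (by
    simp only [SkewOp.op_mk, map_smul, RingHom.id_apply])

/-- The real representation of `G` on `𝔲(V)` by conjugation, `g · X = U_g X U_g†`. -/
def conjRep : Representation ℝ G (SkewOp V) where
  toFun g := SkewOp.conj (φ.toHom g)
  map_one' := LinearMap.ext fun X => SkewOp.op_injective (by simp [SkewOp.conj])
  map_mul' g h := LinearMap.ext fun X => SkewOp.op_injective (by
    simp [SkewOp.conj, mul_assoc])

/-- The abstracted gradient
`∂⟨O⟩_A = Tr (U_{g⁻}† A U_{g⁻} [H, U_{g⁺} O U_{g⁺}†])`, with `H = dφ(h)`. -/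
def abstractGradC (O A : Observable V) (h : GroupLieAlgebra 𝓘(ℝ, E) G) (gp gm : G) : ℂ :=
  let H : V →L[ℂ] V := SkewOp.op (φ.dφ h)
  let O' : V →L[ℂ] V := φ.U gp * (O : V →L[ℂ] V) * star (φ.U gp)
  tr (star (φ.U gm) * (A : V →L[ℂ] V) * φ.U gm * (H * O' - O' * H))

/-- The abstracted gradient is a real number. -/
theorem abstractGradC_im (O A : Observable V) (h : GroupLieAlgebra 𝓘(ℝ, E) G) (gp gm : G) :
    (φ.abstractGradC O A h gp gm).im = 0 := by
  rw [← Complex.conj_eq_iff_im]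
  have hO : star (O : V →L[ℂ] V) = O := selfAdjoint.mem_iff.mp O.2
  have hA : star (A : V →L[ℂ] V) = A := selfAdjoint.mem_iff.mp A.2
  have hH := SkewOp.star_op (φ.dφ h)
  change star _ = _
  unfold abstractGradC
  rw [← tr_star]
  simp only [star_mul, star_sub, star_star, hO, hA, hH]
  rw [tr_mul_comm]
  congr 1
  noncomm_ring

/-- The abstracted gradient as a real number. -/
def abstractGrad (O A : Observable V) (h : GroupLieAlgebra 𝓘(ℝ, E) G) (gp gm : G) : ℝ :=
  (φ.abstractGradC O A h gp gm).re

/-- `GradVar`: the variance of the abstracted gradient `∂⟨O⟩_ρ` for independent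
`(g⁺, g⁻) ∼ μ ⊗ μ`. -/
def gradVar [MeasurableSpace G] (μ : Measure G) (O ρ : Observable V)
    (h : GroupLieAlgebra 𝓘(ℝ, E) G) : ℝ :=
  Var[fun p : G × G => φ.abstractGrad O ρ h p.1 p.2; μ.prod μ]

/-! ### The correlation quantities of two isomorphic subspaces of `𝔲(V)` -/

/-- A `G`-isomorphism `γ : W₂ → W₁` between invariant subspaces of `𝔲(V)`: a linear bijection with
`γ (g · w) = g · γ w`. -/
structure GIso (W₂ W₁ : Submodule ℝ (SkewOp V)) where
  γ : W₂ ≃ₗ[ℝ] W₁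
  equivariant : ∀ (g : G) (w w' : W₂), (w' : SkewOp V) = φ.conjRep g w →
    (γ w' : SkewOp V) = φ.conjRep g (γ w)

variable {φ} {W₁ W₂ : Submodule ℝ (SkewOp V)}

/-- `(γ⁻¹)† : W₂ → W₁`. -/
def GIso.invAdjoint (e : φ.GIso W₂ W₁) : W₂ →ₗ[ℝ] W₁ :=
  LinearMap.adjoint (e.γ.symm : W₁ →ₗ[ℝ] W₂)

/-- `Tr (B₁ γ B₂) · Tr (C₁ (γ⁻¹)† C₂)`, where `i B_j`, `i C_j` are the orthogonal projections of
`i B`, `i C` onto `W_j`; here `Tr (B₁ γ B₂) = -Tr (iB₁ γ(iB₂)) = ⟪iB₁, γ(iB₂)⟫`, and likewise for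
the second factor. -/
def GIso.corrFrob (e : φ.GIso W₂ W₁) (B C : Observable V) : ℝ :=
  ⟪W₁.orthogonalProjectionOnto (SkewOp.ofObs B), e.γ (W₂.orthogonalProjectionOnto (SkewOp.ofObs B))⟫_ℝ *
  ⟪W₁.orthogonalProjectionOnto (SkewOp.ofObs C),
    e.invAdjoint (W₂.orthogonalProjectionOnto (SkewOp.ofObs C))⟫_ℝ

/-- `∑_{j,k} -⟪u_j, (γ⁻¹)† v_k⟫ Tr (P₁[iA, u_j] γ P₂[iA, v_k])` for orthonormal bases `u` of `W₁`
and `v` of `W₂`; the sign is absorbed in `-Tr (X Y) = ⟪X, Y⟫`. -/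
def GIso.corrKill (e : φ.GIso W₂ W₁) (u : OrthonormalBasis (Fin (finrank ℝ W₁)) ℝ W₁)
    (v : OrthonormalBasis (Fin (finrank ℝ W₂)) ℝ W₂) (A : Observable V) : ℝ :=
  ∑ j, ∑ k, ⟪u j, e.invAdjoint (v k)⟫_ℝ *
    ⟪W₁.orthogonalProjectionOnto ⁅SkewOp.ofObs A, (u j : SkewOp V)⁆,
      e.γ (W₂.orthogonalProjectionOnto ⁅SkewOp.ofObs A, (v k : SkewOp V)⁆)⟫_ℝ

variable (φ)

/-- `W₁ ≅ W₂` as representations of `G`. -/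
def Iso (W₁ W₂ : Submodule ℝ (SkewOp V)) : Prop := Nonempty (φ.GIso W₂ W₁)

open Classical in
/-- `(B, C)_{1,2}`, computed with some `G`-isomorphism `γ : W₂ → W₁` (zero if there is none). -/
def corrFrob (W₁ W₂ : Submodule ℝ (SkewOp V)) (B C : Observable V) : ℝ :=
  if e : φ.Iso W₁ W₂ then e.some.corrFrob B C else 0

open Classical in
/-- `(A)_{1,2}`, computed with some `G`-isomorphism `γ : W₂ → W₁` (zero if there is none) and some
orthonormal bases. -/
def corrKill (W₁ W₂ : Submodule ℝ (SkewOp V)) (A : Observable V) : ℝ :=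
  if e : φ.Iso W₁ W₂ then
    e.some.corrKill (stdOrthonormalBasis ℝ W₁) (stdOrthonormalBasis ℝ W₂) A else 0

/-! ### Components -/

/-- The squared Frobenius norm `‖A_W‖_F²` of the component of an observable in `W`. -/
def compNormSq (W : Submodule ℝ (SkewOp V)) (A : Observable V) : ℝ :=
  ‖W.orthogonalProjectionOnto (SkewOp.ofObs A)‖ ^ 2

/-- The subspace `dφ(𝔤_α)` of `𝔲(V)`. -/
def idealSpace (α : SimpleIdeal (GroupLieAlgebra 𝓘(ℝ, E) G)) : Submodule ℝ (SkewOp V) :=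
  (α.1 : Submodule ℝ (GroupLieAlgebra 𝓘(ℝ, E) G)).map φ.dφ

/-- `‖X_{𝔤_α}‖_K²` for `X ∈ 𝔲(V)`: the orthogonal projection of `X` onto `dφ(𝔤_α)` is `dφ(a)` with
`a ∈ 𝔤_α`, and its squared Killing norm is `-B(a, a)`, where `B` is the Killing form of `𝔤_α`.
(The choice of `a` is unique unless `dφ` vanishes on `𝔤_α`.) -/
def killingNormSq (α : SimpleIdeal (GroupLieAlgebra 𝓘(ℝ, E) G)) (X : SkewOp V) : ℝ :=
  let a : α.1 := Function.invFun (fun a : α.1 => φ.dφ a)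
    ((φ.idealSpace α).orthogonalProjectionOnto X : SkewOp V);
  (-killingForm ℝ α.1 a a)

/-- An orthogonal decomposition of the complement `dφ(𝔤)ᶜ ⊆ 𝔲(V)` into irreducible
subrepresentations `W_κ` of the conjugation representation. -/
structure IsComplementDecomposition {K : Type*} (W : K → Subrepresentation φ.conjRep) : Prop where
  irreducible : ∀ κ, (W κ).toRepresentation.IsIrreducible
  orthogonal : Pairwise fun κ κ' => (W κ).toSubmodule ⟂ (W κ').toSubmodule
  iSup_eq : ⨆ κ, (W κ).toSubmodule = (LinearMap.range φ.dφ)ᗮ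

variable {φ} in
open Classical in
/-- The indices `κ` of the complement with `W_κ ≅ W₀`. -/
def isoIndices {K : Type*} [Fintype K] (W : K → Subrepresentation φ.conjRep)
    (W₀ : Submodule ℝ (SkewOp V)) : Finset K :=
  Finset.univ.filter fun κ => φ.Iso (W κ).toSubmodule W₀

variable {φ} in
/-- The components of `𝔲(V)` that are isomorphic to the simple ideal `𝔤_α`: the subspace `dφ(𝔤_α)`
itself, and the `W_κ` with `κ ≅ α`. -/
def dlaComponents {K : Type*} (W : K → Subrepresentation φ.conjRep)
    (α : SimpleIdeal (GroupLieAlgebra 𝓘(ℝ, E) G)) : Set (Submodule ℝ (SkewOp V)) :=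
  {W₁ | W₁ = φ.idealSpace α ∨
    ∃ κ, φ.Iso (W κ).toSubmodule (φ.idealSpace α) ∧ W₁ = (W κ).toSubmodule}

end UnitaryRep

end Representations

end DLA

end

/-! Write q = iO and r = iρ. Up to inverting the second group variable, which preserves Haar
measure, the gradient is the function f(g, k) = ⟪k·r, [H, g·q]⟫ on G × G. Its mean is zero, because
the average of g·q is fixed by G and therefore commutes with H. Hence GradVar is the squared L² norm
of f.

For a simple ideal α let N_α be the sum of all components isomorphic to W_α, and let F_α be the
function built like f from the parts of q and r in N_α. Schur's lemma, applied to averaged operators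
(`avgOp_eq_zero_of_isotypic`), gives ∫ f F_α = ∫ F_α² and ∫ F_α F_β = 0 for α ≠ β, so Bessel's
inequality (`sum_integral_mul_self_le`) yields Σ_α ∫ F_α² ≤ GradVar.

The value of ∫ F_α² rests on one structural fact: the commutant of W_α is ℝ
(`Intertwines.exists_eq_smul`). Every component in N_α is therefore an isometric copy of W_α, and
any G-isomorphism γ between two of them is a scalar c times an isometry, while (γ⁻¹)† is c⁻¹ times
the same isometry. The scalars cancel in both correlation quantities, which makes these independent
of γ. Schur orthogonality, used once in g and once in k, gives ∫ F_α² = d⁻² Tr(ad_H† ad_H) Σ_{i,j}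
(O, ρ)_{i,j}. The trace equals every (iH)_{i,j} and also the squared Killing norm, so splitting the
double sum produces the stated terms.

Two tools stand in for structure theory: a simple ideal is perfect, so linear identities on W_α need
checking only on brackets; and for connected G an ad-invariant subspace is G-invariant
(`conjRep_mem_of_lie_mem`), so W_α is a subrepresentation. -/

noncomputable section

namespace DLA

set_option linter.unusedSectionVars false

/-! ### The commutator on skew-Hermitian operators -/

namespace SkewOp

variable {V : Type*} [NormedAddCommGroup V] [InnerProductSpace ℂ V] [FiniteDimensional ℂ V]

theorem op_lie (X Y : SkewOp V) : op ⁅X, Y⁆ = op X * op Y - op Y * op X := rfl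

/-- The commutator as a bilinear map. -/
def ad : SkewOp V →ₗ[ℝ] SkewOp V →ₗ[ℝ] SkewOp V :=
  LinearMap.mk₂ ℝ (fun X Y => ⁅X, Y⁆)
    (fun X Y Z => op_injective (by simp only [op_lie, map_add]; noncomm_ring))
    (fun c X Y => op_injective (by simp [op_lie, smul_sub]))
    (fun X Y Z => op_injective (by simp only [op_lie, map_add]; noncomm_ring))
    (fun c X Y => op_injective (by simp [op_lie, smul_sub]))

@[simp] theorem ad_apply (X Y : SkewOp V) : ad X Y = ⁅X, Y⁆ := rfl

/-- Cyclicity of the trace makes the Frobenius form invariant. All later transfers of a bracket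
across the inner product use this. -/
theorem inner_lie_left (A X Y : SkewOp V) : ⟪⁅A, X⁆, Y⟫_ℝ = -⟪X, ⁅A, Y⁆⟫_ℝ := by
  have h : tr (op A * op X * op Y) = tr (op X * op Y * op A) := by
    rw [mul_assoc, tr_mul_comm]
  simp only [inner_def, op_lie, sub_mul, mul_sub, tr_sub, Complex.sub_re, h, ← mul_assoc]
  ring

/-- The skew-Hermitian part of an operator. -/
def skewPart : (V →L[ℂ] V) →ₗ[ℝ] SkewOp V where
  toFun A := mk ((1 / 2 : ℝ) • (A - star A)) (by
    rw [star_smul, star_sub, star_star, star_trivial, ← smul_neg, neg_sub])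
  map_add' A B := op_injective (by
    simp only [op_mk, map_add, star_add, ← smul_add]; congr 1; abel)
  map_smul' c A := op_injective (by
    simp only [op_mk, map_smul, RingHom.id_apply, star_smul, star_trivial, ← smul_sub]
    rw [smul_comm])

theorem skewPart_op (X : SkewOp V) : skewPart (op X) = X := op_injective (by
  change (1 / 2 : ℝ) • (op X - star (op X)) = op X
  rw [star_op, sub_neg_eq_add, ← two_smul ℝ (op X), smul_smul]; norm_num)

end SkewOp

open SkewOp

/-! ### Derivatives of the representation and of the conjugation action -/

namespace UnitaryRep

variable {E : Type*} [NormedAddCommGroup E] [NormedSpace ℝ E] [FiniteDimensional ℝ E]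
  {G : Type*} [TopologicalSpace G] [ChartedSpace E G] [Group G] [LieGroup 𝓘(ℝ, E) ∞ G]
  {V : Type*} [NormedAddCommGroup V] [InnerProductSpace ℂ V] [FiniteDimensional ℂ V]
  (φ : UnitaryRep E G V)

theorem U_mul (g k : G) : φ.U (g * k) = φ.U g * φ.U k := by simp [U]

theorem U_one : φ.U 1 = 1 := by simp [U]

theorem U_mul_star (g : G) : φ.U g * star (φ.U g) = 1 :=
  Unitary.mul_star_self_of_mem (φ.toHom g).2

theorem star_U_mul (g : G) : star (φ.U g) * φ.U g = 1 :=
  Unitary.star_mul_self_of_mem (φ.toHom g).2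

theorem star_U (g : G) : star (φ.U g) = φ.U g⁻¹ := by
  rw [U, U, map_inv]; rfl

theorem op_conjRep (g : G) (X : SkewOp V) :
    op (φ.conjRep g X) = φ.U g * op X * star (φ.U g) := rfl

theorem op_dφ (x : GroupLieAlgebra 𝓘(ℝ, E) G) : op (φ.dφ x) = φ.dU x := rfl

theorem mdifferentiableAt_U (g : G) : MDifferentiableAt 𝓘(ℝ, E) 𝓘(ℝ, V →L[ℂ] V) φ.U g :=
  (φ.smooth g).mdifferentiableAt (by simp)

theorem continuous_U : Continuous φ.U := φ.smooth.continuous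

theorem inner_conjRep (g : G) (X Y : SkewOp V) :
    ⟪φ.conjRep g X, φ.conjRep g Y⟫_ℝ = ⟪X, Y⟫_ℝ := by
  simp only [inner_def, op_conjRep]
  rw [show φ.U g * op X * star (φ.U g) * (φ.U g * op Y * star (φ.U g)) =
    φ.U g * (op X * (star (φ.U g) * φ.U g) * op Y * star (φ.U g)) by noncomm_ring,
    tr_mul_comm, star_U_mul, mul_one, mul_assoc, mul_assoc, star_U_mul, mul_one]

theorem hasMFDerivAt_conj (X : SkewOp V) :
    HasMFDerivAt 𝓘(ℝ, E) 𝓘(ℝ, V →L[ℂ] V) (fun g => op (φ.conjRep g X)) (1 : G)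
      (((ContinuousLinearMap.mul ℝ (V →L[ℂ] V)).flip (op X) -
        ContinuousLinearMap.mul ℝ (V →L[ℂ] V) (op X)).comp φ.dU) := by
  have hF := φ.mdifferentiableAt_U 1
  have hS := ((starL' ℝ : (V →L[ℂ] V) ≃L[ℝ] (V →L[ℂ] V)) :
    (V →L[ℂ] V) →L[ℝ] (V →L[ℂ] V)).hasMFDerivAt (x := φ.U 1)
  have hSF := hS.comp (1 : G) hF.hasMFDerivAt
  have hC : HasMFDerivAt 𝓘(ℝ, E) 𝓘(ℝ, V →L[ℂ] V) (fun _ : G => op X) (1 : G) 0 :=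
    hasMFDerivAt_const _ _
  have hP := (hF.hasMFDerivAt.mul' hC).mul' hSF
  refine hP.congr_mfderiv (ContinuousLinearMap.ext fun x => ?_)
  have key : φ.dU x * op X - op X * φ.dU x =
      (φ.U 1 * op X) * star (φ.dU x) +
        (φ.U 1 * 0 + φ.dU x * op X) * star (φ.U 1) := by
    rw [U_one, star_dU]; simp; abel
  exact key.symm

/-- Both sides are functions of g, and their derivatives at the identity must agree. Allowing two
functionals covers invariance of subspaces and equivariance of maps at once. -/
theorem lie_eq_of_conj_eq {F : Type*} [NormedAddCommGroup F] [NormedSpace ℝ F]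
    (l₁ l₂ : SkewOp V →ₗ[ℝ] F) (X Y : SkewOp V)
    (h : ∀ g, l₁ (φ.conjRep g X) = l₂ (φ.conjRep g Y)) (x : GroupLieAlgebra 𝓘(ℝ, E) G) :
    l₁ ⁅φ.dφ x, X⁆ = l₂ ⁅φ.dφ x, Y⁆ := by
  have main : ∀ (l : SkewOp V →ₗ[ℝ] F) (X : SkewOp V), ∃ D : E →L[ℝ] F,
      HasMFDerivAt 𝓘(ℝ, E) 𝓘(ℝ, F) (fun g => l (φ.conjRep g X)) (1 : G) D ∧
      D x = l ⁅φ.dφ x, X⁆ := by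
    intro l X
    have hL := (LinearMap.toContinuousLinearMap (l ∘ₗ skewPart)).hasMFDerivAt
      (x := op (φ.conjRep (1 : G) X))
    have h := hL.comp (1 : G) (φ.hasMFDerivAt_conj X)
    have e : (fun g => l (φ.conjRep g X)) =
        (LinearMap.toContinuousLinearMap (l ∘ₗ skewPart)) ∘ fun g => op (φ.conjRep g X) := by
      funext g
      simp [skewPart_op]
    rw [e]
    refine ⟨_, h, ?_⟩
    · change l (skewPart (φ.dU x * op X - op X * φ.dU x)) = _
      rw [← skewPart_op ⁅φ.dφ x, X⁆]
      rfl
  obtain ⟨D₁, h₁, e₁⟩ := main l₁ X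
  obtain ⟨D₂, h₂, e₂⟩ := main l₂ Y
  rw [← e₁, ← e₂]
  rw [show (fun g => l₁ (φ.conjRep g X)) = fun g => l₂ (φ.conjRep g Y) from funext h] at h₁
  exact DFunLike.congr_fun (hasMFDerivAt_unique h₁ h₂) x

/-- Differentiate U_{gk} = U_g U_k in k at the identity. Left-invariant fields enter because they
define the bracket of the Lie algebra. -/
theorem mfderiv_U_mulInvariantVectorField (x : GroupLieAlgebra 𝓘(ℝ, E) G) (g : G) :
    mfderiv 𝓘(ℝ, E) 𝓘(ℝ, V →L[ℂ] V) φ.U g (mulInvariantVectorField x g) = φ.U g * φ.dU x := by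
  have h1 : HasMFDerivAt 𝓘(ℝ, E) 𝓘(ℝ, E) (g * ·) (1 : G)
      (mfderiv 𝓘(ℝ, E) 𝓘(ℝ, E) (g * ·) (1 : G)) :=
    ((contMDiff_mul_left (I := 𝓘(ℝ, E)) (n := ∞) (a := g)).contMDiffAt.mdifferentiableAt
      (by simp)).hasMFDerivAt
  have h2 : HasMFDerivAt 𝓘(ℝ, E) 𝓘(ℝ, V →L[ℂ] V) φ.U (g * 1)
      (mfderiv 𝓘(ℝ, E) 𝓘(ℝ, V →L[ℂ] V) φ.U (g * 1)) := (φ.mdifferentiableAt_U _).hasMFDerivAt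
  have h3 := h2.comp (1 : G) h1
  have h4 := ((ContinuousLinearMap.mul ℝ (V →L[ℂ] V) (φ.U g)).hasMFDerivAt
    (x := φ.U 1)).comp (1 : G) (φ.mdifferentiableAt_U 1).hasMFDerivAt
  have h5 : φ.U ∘ (g * ·) = (ContinuousLinearMap.mul ℝ (V →L[ℂ] V) (φ.U g)) ∘ φ.U := by
    funext k; simp [U_mul]
  rw [h5] at h3
  have := DFunLike.congr_fun (hasMFDerivAt_unique h3 h4) x
  rw [mul_one] at this
  exact this

/-- Translation on the right, U_k = U_{kg⁻¹} U_g, puts the Lie algebra element to the left of U_g.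
In this form the derivative of g·X along a curve is a bracket with g·X itself. -/
theorem exists_mfderiv_U_eq (g : G) (v : TangentSpace 𝓘(ℝ, E) g) :
    ∃ x, mfderiv 𝓘(ℝ, E) 𝓘(ℝ, V →L[ℂ] V) φ.U g v = φ.dU x * φ.U g := by
  have h1 : HasMFDerivAt 𝓘(ℝ, E) 𝓘(ℝ, E) (· * g⁻¹) g
      (mfderiv 𝓘(ℝ, E) 𝓘(ℝ, E) (· * g⁻¹) g) :=
    ((contMDiff_mul_right (I := 𝓘(ℝ, E)) (n := ∞) (a := g⁻¹)).contMDiffAt.mdifferentiableAt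
      (by simp)).hasMFDerivAt
  have h2 : HasMFDerivAt 𝓘(ℝ, E) 𝓘(ℝ, V →L[ℂ] V) φ.U (g * g⁻¹)
      (mfderiv 𝓘(ℝ, E) 𝓘(ℝ, V →L[ℂ] V) φ.U (g * g⁻¹)) :=
    (φ.mdifferentiableAt_U _).hasMFDerivAt
  have h3 := h2.comp g h1
  have h4 := (((ContinuousLinearMap.mul ℝ (V →L[ℂ] V)).flip (φ.U g)).hasMFDerivAt
    (x := φ.U (g * g⁻¹))).comp g h3
  have h5 : ((ContinuousLinearMap.mul ℝ (V →L[ℂ] V)).flip (φ.U g)) ∘ (φ.U ∘ (· * g⁻¹)) = φ.U := by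
    funext k; simp [← U_mul]
  rw [h5] at h4
  refine ⟨mfderiv 𝓘(ℝ, E) 𝓘(ℝ, E) (· * g⁻¹) g v, ?_⟩
  rw [h4.mfderiv]
  refine congrArg (fun A : V →L[ℂ] V => A * φ.U g) ?_
  have : ∀ k : G, k = 1 → ∀ w : E, (mfderiv 𝓘(ℝ, E) 𝓘(ℝ, V →L[ℂ] V) φ.U k : E →L[ℝ] (V →L[ℂ] V)) w
      = (φ.dU : E →L[ℝ] (V →L[ℂ] V)) w := by
    rintro k rfl w; rfl
  exact this _ (mul_inv_cancel g) _

end UnitaryRep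

/-! ### The differential preserves brackets, and ad-invariance implies invariance -/

namespace UnitaryRep

variable {E : Type*} [NormedAddCommGroup E] [NormedSpace ℝ E] [FiniteDimensional ℝ E]
  {G : Type*} [TopologicalSpace G] [ChartedSpace E G] [Group G] [LieGroup 𝓘(ℝ, E) ∞ G]
  {V : Type*} [NormedAddCommGroup V] [InnerProductSpace ℂ V] [FiniteDimensional ℂ V]
  (φ : UnitaryRep E G V)

theorem contMDiffOn_U_extChartAt_symm (g₀ : G) :
    ContDiffOn ℝ ∞ (φ.U ∘ (extChartAt 𝓘(ℝ, E) g₀).symm) (extChartAt 𝓘(ℝ, E) g₀).target := by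
  rw [← contMDiffOn_iff_contDiffOn]
  exact φ.smooth.comp_contMDiffOn (contMDiffOn_extChartAt_symm g₀)

theorem fderiv_U_extChartAt_symm (g₀ : G) {p : E} (hp : p ∈ (extChartAt 𝓘(ℝ, E) g₀).target) :
    fderiv ℝ (φ.U ∘ (extChartAt 𝓘(ℝ, E) g₀).symm) p =
      (mfderiv 𝓘(ℝ, E) 𝓘(ℝ, V →L[ℂ] V) φ.U ((extChartAt 𝓘(ℝ, E) g₀).symm p)).comp
        (mfderivWithin 𝓘(ℝ, E) 𝓘(ℝ, E) (extChartAt 𝓘(ℝ, E) g₀).symm (Set.range 𝓘(ℝ, E)) p) := by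
  have h1 := (φ.mdifferentiableAt_U ((extChartAt 𝓘(ℝ, E) g₀).symm p)).hasMFDerivAt
  have h2 := (mdifferentiableWithinAt_extChartAt_symm hp).hasMFDerivWithinAt
  rw [← mfderiv_eq_fderiv]
  have h3 := h1.comp_hasMFDerivWithinAt p h2
  refine HasMFDerivAt.mfderiv ?_
  refine h3.hasMFDerivAt ?_
  simp

theorem fderiv_U_mpullback (g₀ : G) {p : E} (hp : p ∈ (extChartAt 𝓘(ℝ, E) g₀).target)
    (x : GroupLieAlgebra 𝓘(ℝ, E) G) :
    fderiv ℝ (φ.U ∘ (extChartAt 𝓘(ℝ, E) g₀).symm) p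
      (VectorField.mpullbackWithin 𝓘(ℝ, E) 𝓘(ℝ, E) (extChartAt 𝓘(ℝ, E) g₀).symm
        (mulInvariantVectorField x) (Set.range 𝓘(ℝ, E)) p) =
      (φ.U ∘ (extChartAt 𝓘(ℝ, E) g₀).symm) p * φ.dU x := by
  rw [fderiv_U_extChartAt_symm φ g₀ hp, VectorField.mpullbackWithin_apply]
  rw [Function.comp_apply, ← φ.mfderiv_U_mulInvariantVectorField]
  refine congrArg (mfderiv 𝓘(ℝ, E) 𝓘(ℝ, V →L[ℂ] V) φ.U ((extChartAt 𝓘(ℝ, E) g₀).symm p)) ?_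
  exact (isInvertible_mfderivWithin_extChartAt_symm hp).self_apply_inverse _

/-- In a chart at 1, let u be the coordinate form of U. Its derivative along the left-invariant
field of x is u · dU(x), so differentiating twice gives products of operators. Symmetry of the
second derivative then turns the derivative along the bracket of fields into a commutator. -/
theorem dφ_lie (x y : GroupLieAlgebra 𝓘(ℝ, E) G) : φ.dφ ⁅x, y⁆ = ⁅φ.dφ x, φ.dφ y⁆ := by
  apply op_injective
  rw [op_lie]
  simp only [op_dφ]
  set ψ := extChartAt 𝓘(ℝ, E) (1 : G) with hψ
  have h1 : (1 : G) = ψ.symm (ψ 1) := (extChartAt_to_inv (I := 𝓘(ℝ, E)) (1 : G)).symm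
  have ht : ψ 1 ∈ ψ.target := mem_extChartAt_target (I := 𝓘(ℝ, E)) (1 : G)
  have hto : ψ.target ∈ nhds (ψ 1) := extChartAt_target_mem_nhds (I := 𝓘(ℝ, E)) (1 : G)
  have hu1 : (φ.U ∘ ψ.symm) (ψ 1) = 1 := by rw [Function.comp_apply, ← h1, U_one]
  let F : GroupLieAlgebra 𝓘(ℝ, E) G → E → E := fun x =>
    VectorField.mpullbackWithin 𝓘(ℝ, E) 𝓘(ℝ, E) ψ.symm (mulInvariantVectorField x)
      (Set.range 𝓘(ℝ, E))
  have hF : ∀ x, DifferentiableAt ℝ (F x) (ψ 1) := by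
    intro x
    have := (mdifferentiableAt_mulInvariantVectorField (I := 𝓘(ℝ, E)) x
      (g := (1 : G))).mdifferentiableWithinAt (s := Set.univ)
    have := this.differentiableWithinAt_mpullbackWithin_vectorField
    exact this.differentiableAt (by simp)
  have hu : ContDiffAt ℝ ∞ (φ.U ∘ ψ.symm) (ψ 1) :=
    (φ.contMDiffOn_U_extChartAt_symm 1).contDiffAt hto
  have hud : DifferentiableAt ℝ (φ.U ∘ ψ.symm) (ψ 1) := hu.differentiableAt (by simp)
  have hderiv : ∀ x y, fderiv ℝ (fun p => fderiv ℝ (φ.U ∘ ψ.symm) p (F x p)) (ψ 1) (F y (ψ 1)) =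
      φ.dU y * φ.dU x := by
    intro x y
    have e : (fun p => fderiv ℝ (φ.U ∘ ψ.symm) p (F x p)) =ᶠ[nhds (ψ 1)]
        fun p => (φ.U ∘ ψ.symm) p * φ.dU x := by
      filter_upwards [hto] with p hp using φ.fderiv_U_mpullback 1 hp x
    rw [e.fderiv_eq, fderiv_mul_const' hud]
    have := φ.fderiv_U_mpullback 1 ht y
    rw [← hψ, hu1, one_mul] at this
    change fderiv ℝ (φ.U ∘ ψ.symm) (ψ 1) (F y (ψ 1)) * φ.dU x = _
    exact congrArg (· * φ.dU x) this
  have key := VectorField.fderiv_apply_lieBracket (V := F x) (W := F y) hu (by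
    rw [minSmoothness_of_isRCLikeNormedField]; exact ENat.LEInfty.out) (hF y) (hF x)
  rw [hderiv, hderiv] at key
  rw [← key, GroupLieAlgebra.bracket_def, VectorField.mlieBracket,
    VectorField.mlieBracketWithin_apply]
  simp only [Set.preimage_univ, Set.univ_inter]
  have hchart : ∀ w : TangentSpace 𝓘(ℝ, E) (1 : G), φ.dU w =
      fderiv ℝ (φ.U ∘ ψ.symm) (ψ 1) (mfderiv 𝓘(ℝ, E) 𝓘(ℝ, E) ψ 1 w) := by
    intro w
    have a1 := (mdifferentiableAt_extChartAt (I := 𝓘(ℝ, E)) (mem_chart_source E (1 : G))).hasMFDerivAt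
    have a2 := hud.hasFDerivAt.hasMFDerivAt.comp (1 : G) a1
    have a3 : (φ.U ∘ ψ.symm) ∘ ψ =ᶠ[nhds 1] φ.U := by
      filter_upwards [extChartAt_source_mem_nhds (I := 𝓘(ℝ, E)) (1 : G)] with g hg
      simp only [Function.comp_apply]
      rw [ψ.left_inv hg]
    have a4 := a2.congr_of_eventuallyEq a3.symm
    exact DFunLike.congr_fun (hasMFDerivAt_unique (φ.mdifferentiableAt_U 1).hasMFDerivAt a4) w
  rw [hchart]
  have hinv : ∀ z : E, mfderiv 𝓘(ℝ, E) 𝓘(ℝ, E) ψ 1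
      ((mfderiv 𝓘(ℝ, E) 𝓘(ℝ, E) ψ (1 : G)).inverse z) = z := fun z =>
    (isInvertible_mfderiv_extChartAt (I := 𝓘(ℝ, E))
      (mem_extChartAt_source (1 : G))).self_apply_inverse z
  refine (congrArg (fderiv ℝ (φ.U ∘ ψ.symm) (ψ 1)) (hinv _)).trans ?_
  change fderiv ℝ (φ.U ∘ ψ.symm) (ψ 1)
    (VectorField.lieBracketWithin ℝ (F x) (F y) (Set.range 𝓘(ℝ, E)) (ψ 1)) = _
  rw [ModelWithCorners.range_eq_univ, VectorField.lieBracketWithin_univ]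

theorem exists_fderiv_U_eq (g₀ : G) {p : E} (hp : p ∈ (extChartAt 𝓘(ℝ, E) g₀).target) (v : E) :
    ∃ x, fderiv ℝ (φ.U ∘ (extChartAt 𝓘(ℝ, E) g₀).symm) p v =
      φ.dU x * (φ.U ∘ (extChartAt 𝓘(ℝ, E) g₀).symm) p := by
  rw [φ.fderiv_U_extChartAt_symm g₀ hp]
  exact φ.exists_mfderiv_U_eq _ _

theorem continuous_conjRep (X : SkewOp V) : Continuous fun g => φ.conjRep g X := by
  have h : (fun g => φ.conjRep g X) =
      fun g => (LinearMap.toContinuousLinearMap (skewPart (V := V)))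
        (φ.U g * op X * star (φ.U g)) := by
    funext g
    rw [← op_conjRep]
    exact (skewPart_op _).symm
  rw [h]
  have := φ.continuous_U
  fun_prop

/-- A curve in the complement of an `ad`-invariant subspace solves a linear differential equation,
hence vanishes identically if it vanishes at time zero. -/
theorem conjRep_mem_of_segment (N : Submodule ℝ (SkewOp V))
    (hN : ∀ x, ∀ X ∈ N, ⁅φ.dφ x, X⁆ ∈ N) (X : SkewOp V) (g₀ : G) {p q : E}
    (hpq : segment ℝ p q ⊆ (extChartAt 𝓘(ℝ, E) g₀).target)
    (hp : φ.conjRep ((extChartAt 𝓘(ℝ, E) g₀).symm p) X ∈ N) :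
    φ.conjRep ((extChartAt 𝓘(ℝ, E) g₀).symm q) X ∈ N := by
  set ψ := extChartAt 𝓘(ℝ, E) g₀ with hψ
  set u := φ.U ∘ ψ.symm with hu
  let c : ℝ → E := fun t => p + t • (q - p)
  have hc : ∀ t ∈ Set.Icc (0 : ℝ) 1, c t ∈ ψ.target := fun t ht => hpq (by
    rw [segment_eq_image']; exact ⟨t, ht, rfl⟩)
  have hcd : ∀ t, HasDerivAt c (q - p) t := fun t => by
    simpa [c] using ((hasDerivAt_id t).smul_const (q - p)).const_add p
  have hto : IsOpen ψ.target := isOpen_extChartAt_target g₀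
  have hus : ContDiffOn ℝ ∞ u ψ.target := φ.contMDiffOn_U_extChartAt_symm g₀
  have hud : ∀ t ∈ Set.Icc (0 : ℝ) 1,
      HasDerivAt (fun t => u (c t)) (fderiv ℝ u (c t) (q - p)) t := fun t ht =>
    (((hus.contDiffAt (hto.mem_nhds (hc t ht))).differentiableAt
      (by simp)).hasFDerivAt).comp_hasDerivAt t (hcd t)
  have hcc : Continuous c := by fun_prop
  -- By right translation this operator is dU(x) for an x depending on t. Continuity of the product
  -- gives a uniform bound on dU(x) without choosing x continuously.
  have hcon : ContinuousOn (fun t => fderiv ℝ u (c t) (q - p) * star (u (c t)))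
      (Set.Icc 0 1) := by
    have h1 : ContinuousOn (fun t => fderiv ℝ u (c t)) (Set.Icc 0 1) :=
      (hus.continuousOn_fderiv_of_isOpen hto (by simp)).comp hcc.continuousOn hc
    have h2 : ContinuousOn (fun t => u (c t)) (Set.Icc 0 1) :=
      hus.continuousOn.comp hcc.continuousOn hc
    exact (h1.clm_apply continuousOn_const).mul (continuous_star.comp_continuousOn h2)
  obtain ⟨M, hM⟩ := isCompact_Icc.exists_bound_of_continuousOn hcon
  let Q : SkewOp V →L[ℝ] SkewOp V := Nᗮ.starProjection
  let sp : (V →L[ℂ] V) →L[ℝ] SkewOp V := LinearMap.toContinuousLinearMap skewPart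
  let o : SkewOp V →L[ℝ] (V →L[ℂ] V) := LinearMap.toContinuousLinearMap op
  have hQ : ∀ Y, Q Y = 0 ↔ Y ∈ N := fun Y => by
    rw [Submodule.starProjection_apply_eq_zero_iff, Submodule.orthogonal_orthogonal]
  let f : ℝ → SkewOp V := fun t => Q (φ.conjRep (ψ.symm (c t)) X)
  let f' : ℝ → SkewOp V := fun t => Q (sp (fderiv ℝ u (c t) (q - p) * (o X * star (u (c t))) +
    u (c t) * (o X * star (fderiv ℝ u (c t) (q - p)))))
  have hf : ∀ t ∈ Set.Icc (0 : ℝ) 1, HasDerivAt f (f' t) t := by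
    intro t ht
    have h1 := hud t ht
    have h2 : HasDerivAt (fun t => star (u (c t))) (star (fderiv ℝ u (c t) (q - p))) t :=
      ((starL' ℝ : (V →L[ℂ] V) ≃L[ℝ] (V →L[ℂ] V)) :
        (V →L[ℂ] V) →L[ℝ] (V →L[ℂ] V)).hasFDerivAt.comp_hasDerivAt t h1
    have h3 := h1.mul (h2.const_mul (o X))
    have h4 := (Q.comp sp).hasFDerivAt.comp_hasDerivAt t h3
    refine h4.congr_of_eventuallyEq (Filter.Eventually.of_forall fun s => ?_)
    change Q _ = Q (sp _)
    congr 1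
    rw [← skewPart_op (φ.conjRep (ψ.symm (c s)) X), op_conjRep, mul_assoc]
    rfl
  have hbound : ∀ t ∈ Set.Ico (0 : ℝ) 1, ‖f' t‖ ≤ (‖Q‖ * (‖sp‖ * (2 * (M * ‖o‖)))) * ‖f t‖ := by
    intro t ht
    have ht' := Set.Ico_subset_Icc_self ht
    obtain ⟨x, hx⟩ := φ.exists_fderiv_U_eq g₀ (hc t ht') (q - p)
    set Y := φ.conjRep (ψ.symm (c t)) X with hY
    have huu : u (c t) * star (u (c t)) = 1 := φ.U_mul_star _
    have hA : ‖φ.dU x‖ ≤ M := by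
      have := hM t ht'
      rwa [hx, mul_assoc, huu, mul_one] at this
    have e1 : f' t = Q ⁅φ.dφ x, Y⁆ := by
      change Q _ = _
      congr 1
      rw [hx, ← skewPart_op ⁅φ.dφ x, Y⁆, op_lie, hY, op_conjRep, op_dφ, star_mul, star_dU]
      change skewPart _ = skewPart _
      congr 1
      change φ.dU x * u (c t) * (op X * star (u (c t))) +
        u (c t) * (op X * (star (u (c t)) * -φ.dU x)) =
        φ.dU x * (u (c t) * op X * star (u (c t))) - u (c t) * op X * star (u (c t)) * φ.dU x
      noncomm_ring
    -- The bracket maps N into N, so only the part of Y orthogonal to N contributes. This makes the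
    -- equation for f closed and linear.
    have e2 : Q ⁅φ.dφ x, Y⁆ = Q ⁅φ.dφ x, Q Y⁆ := by
      have h1 : Y - Q Y ∈ N := by
        rw [← hQ, map_sub, sub_eq_zero]
        exact (Submodule.starProjection_eq_self_iff.2 (Submodule.starProjection_apply_mem _ _)).symm
      have h2 := (hQ _).2 (hN x _ h1)
      rw [← ad_apply, map_sub, map_sub, sub_eq_zero] at h2
      exact h2
    have e3 : ⁅φ.dφ x, f t⁆ = sp (φ.dU x * o (f t) - o (f t) * φ.dU x) := (skewPart_op _).symm
    rw [e1, e2]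
    change ‖Q ⁅φ.dφ x, f t⁆‖ ≤ _
    rw [e3]
    have h5 : ‖φ.dU x * o (f t) - o (f t) * φ.dU x‖ ≤ 2 * (M * ‖o‖) * ‖f t‖ := by
      have ho : ‖o (f t)‖ ≤ ‖o‖ * ‖f t‖ := o.le_opNorm _
      have hM0 : 0 ≤ M := (norm_nonneg _).trans hA
      calc _ ≤ ‖φ.dU x * o (f t)‖ + ‖o (f t) * φ.dU x‖ := norm_sub_le _ _
        _ ≤ ‖φ.dU x‖ * ‖o (f t)‖ + ‖o (f t)‖ * ‖φ.dU x‖ :=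
          add_le_add (norm_mul_le _ _) (norm_mul_le _ _)
        _ = 2 * (‖φ.dU x‖ * ‖o (f t)‖) := by ring
        _ ≤ 2 * (M * (‖o‖ * ‖f t‖)) := by gcongr
        _ = _ := by ring
    calc _ ≤ ‖Q‖ * (‖sp‖ * ‖φ.dU x * o (f t) - o (f t) * φ.dU x‖) :=
          (Q.le_opNorm _).trans (by gcongr; exact sp.le_opNorm _)
      _ ≤ ‖Q‖ * (‖sp‖ * (2 * (M * ‖o‖) * ‖f t‖)) := by gcongr
      _ = _ := by ring
  have h0 : f 0 = 0 := (hQ _).2 (by simpa [c] using hp)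
  -- Grönwall: f(0) = 0 and ‖f'‖ ≤ C‖f‖ force f = 0 on the whole segment.
  have := eq_zero_of_abs_deriv_le_mul_abs_self_of_eq_zero_right
    (fun t ht => (hf t ht).continuousAt.continuousWithinAt)
    (fun t ht => (hf t (Set.Ico_subset_Icc_self ht)).hasDerivWithinAt) h0 hbound 1 (by simp)
  have h1 := (hQ _).1 this
  simpa [c] using h1

/-- On a connected Lie group, `ad`-invariant subspaces are invariant. -/
theorem conjRep_mem_of_lie_mem [ConnectedSpace G] (N : Submodule ℝ (SkewOp V))
    (hN : ∀ x, ∀ X ∈ N, ⁅φ.dφ x, X⁆ ∈ N) (g : G) {X : SkewOp V} (hX : X ∈ N) :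
    φ.conjRep g X ∈ N := by
  let S : Set G := {g | φ.conjRep g X ∈ N}
  suffices hS : IsClopen S by
    have := hS.eq_univ ⟨1, by simpa [S] using hX⟩
    exact this.ge (Set.mem_univ g)
  refine ⟨?_, ?_⟩
  · exact (Submodule.closed_of_finiteDimensional N).preimage (φ.continuous_conjRep X)
  -- Openness: in a chart, a ball around the image of g₀ is convex, so each nearby point is joined
  -- to g₀ by a segment to which the differential equation applies.
  · rw [isOpen_iff_mem_nhds]
    intro g₀ hg₀
    set ψ := extChartAt 𝓘(ℝ, E) g₀ with hψ
    obtain ⟨r, hr, hb⟩ := Metric.mem_nhds_iff.1 (extChartAt_target_mem_nhds (I := 𝓘(ℝ, E)) g₀)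
    have hc : ψ ⁻¹' Metric.ball (ψ g₀) r ∈ nhds g₀ :=
      (continuousAt_extChartAt g₀).preimage_mem_nhds (Metric.ball_mem_nhds _ hr)
    filter_upwards [hc, extChartAt_source_mem_nhds (I := 𝓘(ℝ, E)) g₀] with k hk hks
    have h1 : ψ.symm (ψ g₀) = g₀ := ψ.left_inv (mem_extChartAt_source g₀)
    have h2 : ψ.symm (ψ k) = k := ψ.left_inv hks
    have := φ.conjRep_mem_of_segment N hN X g₀ (p := ψ g₀) (q := ψ k)
      (((convex_ball _ _).segment_subset (Metric.mem_ball_self hr) hk).trans hb)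
      (by rw [← hψ, h1]; exact hg₀)
    rw [← hψ, h2] at this
    exact this

end UnitaryRep

/-- The derived ideal is zero or everything, and it cannot be zero because a simple algebra is not
abelian. -/
theorem SimpleIdeal.span_lie_eq_top {L : Type*} [LieRing L] [LieAlgebra ℝ L] (α : SimpleIdeal L) :
    Submodule.span ℝ {c : α.1 | ∃ a b : α.1, ⁅a, b⁆ = c} = ⊤ := by
  have hα : LieAlgebra.IsSimple ℝ α.1 := α.2
  have h : (⁅(⊤ : LieIdeal ℝ α.1), (⊤ : LieIdeal ℝ α.1)⁆ : LieIdeal ℝ α.1).toSubmodule =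
      Submodule.span ℝ {c : α.1 | ∃ a b : α.1, ⁅a, b⁆ = c} := by
    rw [LieSubmodule.lieIdeal_oper_eq_linear_span']
    congr 1
    ext c
    simp
  rw [← h]
  rcases hα.eq_bot_or_eq_top ⁅(⊤ : LieIdeal ℝ α.1), (⊤ : LieIdeal ℝ α.1)⁆ with h0 | h0
  · refine absurd ⟨fun x y => ?_⟩ hα.non_abelian
    rw [← LieSubmodule.mem_bot (R := ℝ) (L := α.1), ← h0]
    exact LieSubmodule.lie_mem_lie (LieSubmodule.mem_top x) (LieSubmodule.mem_top y)
  · rw [h0]; simp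

namespace SkewOp

variable {V : Type*} [NormedAddCommGroup V] [InnerProductSpace ℂ V] [FiniteDimensional ℂ V]

theorem neg_lie_swap (X Y : SkewOp V) : -⁅Y, X⁆ = ⁅X, Y⁆ := op_injective (by
  rw [map_neg, op_lie, op_lie, neg_sub])

theorem lie_zero_right (X : SkewOp V) : ⁅X, (0 : SkewOp V)⁆ = 0 := map_zero (ad X)

theorem lie_add_right (X Y Z : SkewOp V) : ⁅X, Y + Z⁆ = ⁅X, Y⁆ + ⁅X, Z⁆ := map_add (ad X) Y Z

theorem lie_sub_left (X Y Z : SkewOp V) : ⁅X - Y, Z⁆ = ⁅X, Z⁆ - ⁅Y, Z⁆ := by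
  simp only [← ad_apply, map_sub, LinearMap.sub_apply]

end SkewOp

/-! ### Invariant subspaces and intertwining maps -/

namespace UnitaryRep

variable {E : Type*} [NormedAddCommGroup E] [NormedSpace ℝ E] [FiniteDimensional ℝ E]
  {G : Type*} [TopologicalSpace G] [ChartedSpace E G] [Group G] [LieGroup 𝓘(ℝ, E) ∞ G]
  {V : Type*} [NormedAddCommGroup V] [InnerProductSpace ℂ V] [FiniteDimensional ℂ V]
  (φ : UnitaryRep E G V)

/-- A subspace of `𝔲(V)` invariant under conjugation. -/
def IsInvariant (N : Submodule ℝ (SkewOp V)) : Prop :=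
  ∀ g, ∀ X ∈ N, φ.conjRep g X ∈ N

/-- A linear map from a subspace of `𝔲(V)` that commutes with conjugation. -/
def Intertwines {N : Submodule ℝ (SkewOp V)} (T : N →ₗ[ℝ] SkewOp V) : Prop :=
  ∀ (g : G) (w w' : N), (w' : SkewOp V) = φ.conjRep g w → T w' = φ.conjRep g (T w)

variable {φ}

theorem conjRep_inv_conjRep (g : G) (X : SkewOp V) : φ.conjRep g⁻¹ (φ.conjRep g X) = X := by
  rw [← Module.End.mul_apply, ← map_mul]; simp

theorem inner_conjRep_left (g : G) (X Y : SkewOp V) :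
    ⟪φ.conjRep g X, Y⟫_ℝ = ⟪X, φ.conjRep g⁻¹ Y⟫_ℝ := by
  rw [← φ.inner_conjRep g⁻¹, conjRep_inv_conjRep]

theorem IsInvariant.orthogonal {N : Submodule ℝ (SkewOp V)} (hN : φ.IsInvariant N) :
    φ.IsInvariant Nᗮ := by
  intro g X hX
  rw [Submodule.mem_orthogonal'] at hX ⊢
  intro u hu
  rw [inner_conjRep_left]
  exact hX _ (hN _ _ hu)

theorem IsInvariant.starProjection_conjRep {N : Submodule ℝ (SkewOp V)} (hN : φ.IsInvariant N)
    (g : G) (X : SkewOp V) :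
    N.starProjection (φ.conjRep g X) = φ.conjRep g (N.starProjection X) := by
  refine Submodule.eq_starProjection_of_mem_of_inner_eq_zero
    (hN g _ (Submodule.starProjection_apply_mem _ _)) fun w hw => ?_
  rw [← map_sub, inner_conjRep_left]
  exact Submodule.starProjection_inner_eq_zero _ _ (hN _ _ hw)

/-- Differentiate the vanishing of the projection of g·X onto the orthogonal complement of N. -/
theorem IsInvariant.lie_mem {N : Submodule ℝ (SkewOp V)} (hN : φ.IsInvariant N)
    (x : GroupLieAlgebra 𝓘(ℝ, E) G) {X : SkewOp V} (hX : X ∈ N) : ⁅φ.dφ x, X⁆ ∈ N := by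
  have := φ.lie_eq_of_conj_eq (Nᗮ.starProjection : SkewOp V →ₗ[ℝ] SkewOp V) 0 X X
    (fun g => by
      simp only [LinearMap.zero_apply]
      refine (Submodule.starProjection_apply_eq_zero_iff _).2 ?_
      rw [Submodule.orthogonal_orthogonal]
      exact hN g X hX) x
  have := (Submodule.starProjection_apply_eq_zero_iff _).1 this
  rwa [Submodule.orthogonal_orthogonal] at this

theorem orthogonalProjectionOnto_coe {N : Submodule ℝ (SkewOp V)} (w : N) :
    N.orthogonalProjectionOnto (w : SkewOp V) = w :=
  Submodule.orthogonalProjectionOnto_mem_subspace_eq_self w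

theorem orthogonalProjectionOnto_of_mem {N : Submodule ℝ (SkewOp V)} {X : SkewOp V} (h : X ∈ N) :
    N.orthogonalProjectionOnto X = ⟨X, h⟩ :=
  orthogonalProjectionOnto_coe (⟨X, h⟩ : N)

theorem Intertwines.map_lie {N : Submodule ℝ (SkewOp V)} (hN : φ.IsInvariant N)
    {T : N →ₗ[ℝ] SkewOp V} (hT : φ.Intertwines T) (x : GroupLieAlgebra 𝓘(ℝ, E) G) (w w' : N)
    (hw : (w' : SkewOp V) = ⁅φ.dφ x, (w : SkewOp V)⁆) : T w' = ⁅φ.dφ x, T w⁆ := by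
  -- Precomposing with the projection onto N extends T to all of 𝔲(V), so that both sides are
  -- functionals of a conjugation orbit.
  have := φ.lie_eq_of_conj_eq (T ∘ₗ (N.orthogonalProjectionOnto : SkewOp V →ₗ[ℝ] N))
    LinearMap.id w (T w) (fun g => by
      simp only [LinearMap.comp_apply, LinearMap.id_apply, ContinuousLinearMap.coe_coe]
      rw [orthogonalProjectionOnto_of_mem (hN g w w.2)]
      exact hT g w _ rfl) x
  simpa [← hw, orthogonalProjectionOnto_coe] using this

/-! ### The subspaces `dφ(𝔤_α)` -/

variable {α : SimpleIdeal (GroupLieAlgebra 𝓘(ℝ, E) G)}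

variable (φ α) in
/-- The restriction of `dφ` to a simple ideal. -/
def idealMap : α.1 →ₗ[ℝ] SkewOp V where
  toFun a := φ.dφ a
  map_add' a b := map_add φ.dφ (a : GroupLieAlgebra 𝓘(ℝ, E) G) b
  map_smul' c a := map_smul φ.dφ c (a : GroupLieAlgebra 𝓘(ℝ, E) G)

theorem mem_idealSpace {X : SkewOp V} : X ∈ φ.idealSpace α ↔ ∃ a : α.1, φ.dφ a = X := by
  constructor
  · rintro ⟨a, ha, rfl⟩
    exact ⟨⟨a, ha⟩, rfl⟩
  · rintro ⟨a, rfl⟩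
    exact ⟨a, a.2, rfl⟩

theorem dφ_mem_idealSpace (a : α.1) : φ.dφ a ∈ φ.idealSpace α := mem_idealSpace.2 ⟨a, rfl⟩

theorem lie_mem_idealSpace (x : GroupLieAlgebra 𝓘(ℝ, E) G) {X : SkewOp V}
    (hX : X ∈ φ.idealSpace α) : ⁅φ.dφ x, X⁆ ∈ φ.idealSpace α := by
  obtain ⟨a, rfl⟩ := mem_idealSpace.1 hX
  rw [← dφ_lie]
  exact ⟨_, α.1.lie_mem a.2, rfl⟩

theorem isInvariant_idealSpace [ConnectedSpace G] : φ.IsInvariant (φ.idealSpace α) :=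
  fun g _ hX => φ.conjRep_mem_of_lie_mem _ (fun x _ hY => lie_mem_idealSpace x hY) g hX

/-- The simple ideal is perfect, hence so is its image. -/
theorem idealSpace_le_of_lie_mem {N : Submodule ℝ (SkewOp V)}
    (hN : ∀ a b : α.1, ⁅φ.dφ a, φ.dφ b⁆ ∈ N) : φ.idealSpace α ≤ N := by
  intro X hX
  obtain ⟨a, rfl⟩ := mem_idealSpace.1 hX
  have h : (⊤ : Submodule ℝ α.1) ≤ N.comap (φ.idealMap α) := by
    rw [← α.span_lie_eq_top, Submodule.span_le]
    rintro _ ⟨a, b, rfl⟩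
    change φ.dφ (⁅a, b⁆ : α.1) ∈ N
    rw [LieIdeal.coe_bracket_of_module, LieSubmodule.coe_bracket, dφ_lie]
    exact hN a b
  exact h (Submodule.mem_top (x := a))

/-- The preimage of N in 𝔤_α is an ideal, and 𝔤_α is simple. -/
theorem eq_bot_or_idealSpace_le {N : Submodule ℝ (SkewOp V)} (hle : N ≤ φ.idealSpace α)
    (hN : ∀ a : α.1, ∀ X ∈ N, ⁅φ.dφ a, X⁆ ∈ N) : N = ⊥ ∨ φ.idealSpace α ≤ N := by
  let I : LieIdeal ℝ α.1 :=
    { N.comap (φ.idealMap α) with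
      lie_mem := fun {a b} hb => by
        change φ.dφ (⁅a, b⁆ : α.1) ∈ N
        rw [LieIdeal.coe_bracket_of_module, LieSubmodule.coe_bracket, dφ_lie]
        exact hN a _ hb }
  have hI : ∀ a : α.1, a ∈ I ↔ φ.dφ a ∈ N := fun a => Iff.rfl
  rcases α.2.eq_bot_or_eq_top I with h | h
  · left
    rw [Submodule.eq_bot_iff]
    intro X hX
    obtain ⟨a, rfl⟩ := mem_idealSpace.1 (hle hX)
    have := (hI a).2 hX
    rw [h, LieSubmodule.mem_bot] at this
    simp [this]
  · right
    intro X hX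
    obtain ⟨a, rfl⟩ := mem_idealSpace.1 hX
    exact (hI a).1 (h ▸ LieSubmodule.mem_top a)

/-- The bracket lies in W_α because Z comes from 𝔤, and in its complement because the form is
invariant. This supplies a commuting complement of W_α in dφ(𝔤) without decomposing 𝔤. -/
theorem lie_eq_zero_of_mem_range_of_mem_orthogonal {X Z : SkewOp V} (hX : X ∈ φ.idealSpace α)
    (hZ : Z ∈ LinearMap.range φ.dφ) (hZ' : Z ∈ (φ.idealSpace α)ᗮ) : ⁅X, Z⁆ = 0 := by
  have h1 : ⁅X, Z⁆ ∈ φ.idealSpace α := by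
    obtain ⟨z, rfl⟩ := hZ
    rw [← neg_lie_swap]
    exact neg_mem (lie_mem_idealSpace z hX)
  have h2 : ⁅X, Z⁆ ∈ (φ.idealSpace α)ᗮ := by
    rw [Submodule.mem_orthogonal']
    intro Y hY
    obtain ⟨x, rfl⟩ := mem_idealSpace.1 hX
    rw [inner_lie_left, neg_eq_zero]
    exact (Submodule.mem_orthogonal' _ _).1 hZ' _ (lie_mem_idealSpace _ hY)
  have := Submodule.inner_right_of_mem_orthogonal h1 h2
  exact inner_self_eq_zero.1 this

/-- On a bracket, T[a, b] = [a, T b], which vanishes because the values of T commute with W_α.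
Perfectness does the rest. -/
theorem Intertwines.eq_zero_of_mem_range [ConnectedSpace G]
    {T : φ.idealSpace α →ₗ[ℝ] SkewOp V} (hT : φ.Intertwines T)
    (h₁ : ∀ w, T w ∈ LinearMap.range φ.dφ) (h₂ : ∀ w, T w ∈ (φ.idealSpace α)ᗮ) : T = 0 := by
  have h : φ.idealSpace α ≤ (LinearMap.ker T).map (φ.idealSpace α).subtype := by
    refine idealSpace_le_of_lie_mem fun a b => ?_
    refine ⟨⟨_, lie_mem_idealSpace _ (dφ_mem_idealSpace b)⟩, ?_, rfl⟩
    rw [SetLike.mem_coe, LinearMap.mem_ker,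
      hT.map_lie isInvariant_idealSpace a ⟨_, dφ_mem_idealSpace b⟩ _ rfl]
    exact lie_eq_zero_of_mem_range_of_mem_orthogonal (dφ_mem_idealSpace a) (h₁ _) (h₂ _)
  ext1 w
  obtain ⟨w', hw', e⟩ := h w.2
  rw [← Subtype.ext e]
  exact hw'

/-- The commutant of a compact simple ideal is `ℝ`. -/
theorem Intertwines.exists_eq_smul [ConnectedSpace G]
    (S : φ.idealSpace α →ₗ[ℝ] φ.idealSpace α)
    (hT : φ.Intertwines ((φ.idealSpace α).subtype ∘ₗ S)) : ∃ c : ℝ, ∀ w, S w = c • w := by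
  rcases subsingleton_or_nontrivial (φ.idealSpace α) with hs | hs
  · exact ⟨0, fun w => Subsingleton.elim _ _⟩
  have hS : ∀ (a : GroupLieAlgebra 𝓘(ℝ, E) G) (w w' : φ.idealSpace α),
      (w' : SkewOp V) = ⁅φ.dφ a, (w : SkewOp V)⁆ → (S w' : SkewOp V) = ⁅φ.dφ a, (S w : SkewOp V)⁆ :=
    fun a w w' hw => hT.map_lie isInvariant_idealSpace a w w' hw
  -- Commuting with ad gives S[a, b] = [Sa, b] = [a, Sb]. Hence ⟪S[a, b], z⟫ = -⟪b, [Sa, z]⟫ = -⟪b,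
  -- [a, Sz]⟫ = ⟪[a, b], Sz⟫, and brackets span. Symmetry provides a real eigenvalue.
  have hsym : S.IsSymmetric := by
    suffices h : S = LinearMap.adjoint S by
      intro x y
      conv_rhs => rw [h]
      rw [LinearMap.adjoint_inner_right]
    have h : φ.idealSpace α ≤
        (LinearMap.ker (S - LinearMap.adjoint S)).map (φ.idealSpace α).subtype := by
      refine idealSpace_le_of_lie_mem fun a b => ?_
      refine ⟨⟨_, lie_mem_idealSpace _ (dφ_mem_idealSpace b)⟩, ?_, rfl⟩
      rw [SetLike.mem_coe, LinearMap.mem_ker, LinearMap.sub_apply, sub_eq_zero]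
      refine ext_inner_right ℝ fun z => ?_
      rw [LinearMap.adjoint_inner_left]
      obtain ⟨c, hc⟩ := mem_idealSpace.1 z.2
      let A : φ.idealSpace α := ⟨_, dφ_mem_idealSpace a⟩
      let B : φ.idealSpace α := ⟨_, dφ_mem_idealSpace b⟩
      set w : φ.idealSpace α := ⟨_, lie_mem_idealSpace _ (dφ_mem_idealSpace b)⟩ with hw
      have e1 : (S w : SkewOp V) = ⁅(S A : SkewOp V), φ.dφ b⁆ := by
        rw [← neg_lie_swap, ← hS b A (-w) (by rw [Submodule.coe_neg, hw, neg_lie_swap]), map_neg,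
          Submodule.coe_neg, neg_neg]
      let y : φ.idealSpace α := ⟨_, lie_mem_idealSpace (φ := φ) (a : GroupLieAlgebra 𝓘(ℝ, E) G) z.2⟩
      have e2 : (S y : SkewOp V) = ⁅φ.dφ a, (S z : SkewOp V)⁆ := hS a z y rfl
      have e3 : (S y : SkewOp V) = ⁅(S A : SkewOp V), (z : SkewOp V)⁆ := by
        rw [← neg_lie_swap, ← hc, ← hS c A (-y) (by
          rw [Submodule.coe_neg, hc, neg_lie_swap]), map_neg, Submodule.coe_neg, neg_neg]
      rw [Submodule.coe_inner, Submodule.coe_inner, e1, inner_lie_left, ← e3, e2, hw,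
        inner_lie_left]
    ext1 w
    obtain ⟨w', hw', e⟩ := h w.2
    rw [← Subtype.ext e]
    exact sub_eq_zero.1 hw'
  obtain ⟨c, hc⟩ : ∃ c : ℝ, Module.End.HasEigenvalue S c :=
    ⟨_, hsym.hasEigenvalue_iSup_of_finiteDimensional⟩
  refine ⟨c, ?_⟩
  have hle : (Module.End.eigenspace S c).map (φ.idealSpace α).subtype ≤ φ.idealSpace α := by
    rintro _ ⟨w, -, rfl⟩; exact w.2
  have hinv : ∀ a : α.1, ∀ X ∈ (Module.End.eigenspace S c).map (φ.idealSpace α).subtype,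
      ⁅φ.dφ a, X⁆ ∈ (Module.End.eigenspace S c).map (φ.idealSpace α).subtype := by
    rintro a _ ⟨w, hw, rfl⟩
    refine ⟨⟨_, lie_mem_idealSpace (φ := φ) (a : GroupLieAlgebra 𝓘(ℝ, E) G) w.2⟩, ?_, rfl⟩
    rw [SetLike.mem_coe, Module.End.mem_eigenspace_iff] at hw ⊢
    apply Subtype.ext
    rw [hS a w _ rfl, hw, Submodule.coe_smul, Submodule.coe_smul]
    exact map_smul (ad (φ.dφ a)) c (w : SkewOp V)
  -- The eigenspace is ad-invariant and contains an eigenvector, so it is all of W_α.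
  rcases eq_bot_or_idealSpace_le hle hinv with h | h
  · obtain ⟨v, hv, hv0⟩ := hc.exists_hasEigenvector
    have : (v : SkewOp V) ∈ (Module.End.eigenspace S c).map (φ.idealSpace α).subtype :=
      ⟨v, hv, rfl⟩
    rw [h, Submodule.mem_bot] at this
    exact absurd (Subtype.ext this) hv0
  · intro w
    obtain ⟨w', hw', e⟩ := h w.2
    rw [← Subtype.ext e]
    exact Module.End.mem_eigenspace_iff.1 hw'

end UnitaryRep

/-! ### Isomorphisms of components and Schur's lemma -/

namespace UnitaryRep

variable {E : Type*} [NormedAddCommGroup E] [NormedSpace ℝ E] [FiniteDimensional ℝ E]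
  {G : Type*} [TopologicalSpace G] [ChartedSpace E G] [Group G] [LieGroup 𝓘(ℝ, E) ∞ G]
  {V : Type*} [NormedAddCommGroup V] [InnerProductSpace ℂ V] [FiniteDimensional ℂ V]
  {φ : UnitaryRep E G V} {α : SimpleIdeal (GroupLieAlgebra 𝓘(ℝ, E) G)}

theorem inner_smul_left_coe {N : Submodule ℝ (SkewOp V)} (c : ℝ) (x y : N) :
    ⟪c • x, y⟫_ℝ = c * ⟪x, y⟫_ℝ := real_inner_smul_left x y c

theorem inner_smul_right_coe {N : Submodule ℝ (SkewOp V)} (c : ℝ) (x y : N) :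
    ⟪x, c • y⟫_ℝ = c * ⟪x, y⟫_ℝ := real_inner_smul_right x y c

theorem GIso.intertwines {W₁ W₂ : Submodule ℝ (SkewOp V)} (e : φ.GIso W₂ W₁) :
    φ.Intertwines (W₁.subtype ∘ₗ (e.γ : W₂ →ₗ[ℝ] W₁)) := e.equivariant

/-- The inverse of a `G`-isomorphism out of an invariant subspace. -/
def GIso.symm {W₁ W₂ : Submodule ℝ (SkewOp V)} (e : φ.GIso W₂ W₁) (h₂ : φ.IsInvariant W₂) :
    φ.GIso W₁ W₂ where
  γ := e.γ.symm
  equivariant g w w' hw := by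
    have h := e.equivariant g (e.γ.symm w) ⟨_, h₂ g _ (e.γ.symm w).2⟩ rfl
    rw [LinearEquiv.apply_symm_apply, ← hw] at h
    rw [← Subtype.ext h, LinearEquiv.symm_apply_apply]

theorem GIso.isInvariant {W₁ W₂ : Submodule ℝ (SkewOp V)} (e : φ.GIso W₂ W₁)
    (h₂ : φ.IsInvariant W₂) : φ.IsInvariant W₁ := by
  intro g X hX
  have h := e.equivariant g (e.γ.symm ⟨X, hX⟩) ⟨_, h₂ g _ (e.γ.symm ⟨X, hX⟩).2⟩ rfl
  rw [LinearEquiv.apply_symm_apply] at h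
  rw [← h]
  exact Subtype.mem _

/-- Composition of `G`-isomorphisms. -/
def GIso.trans {W₁ W₂ W₃ : Submodule ℝ (SkewOp V)} (e : φ.GIso W₃ W₂) (f : φ.GIso W₂ W₁) :
    φ.GIso W₃ W₁ where
  γ := e.γ.trans f.γ
  equivariant g w w' hw := f.equivariant g _ _ (e.equivariant g w w' hw)

theorem isInvariant_toSubmodule (W : Subrepresentation φ.conjRep) : φ.IsInvariant W.toSubmodule :=
  fun g _ hX => W.apply_mem_toSubmodule g hX

/-- Schur's lemma for maps between the image of a simple ideal and an irreducible component. -/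
theorem Intertwines.eq_zero_or_iso [ConnectedSpace G] (W : Subrepresentation φ.conjRep)
    (hW : W.toRepresentation.IsIrreducible) (T : φ.idealSpace α →ₗ[ℝ] W.toSubmodule)
    (hT : φ.Intertwines (W.toSubmodule.subtype ∘ₗ T)) :
    T = 0 ∨ φ.Iso W.toSubmodule (φ.idealSpace α) := by
  by_cases h0 : T = 0
  · exact Or.inl h0
  right
  have hker : LinearMap.ker T = ⊥ := by
    have hle : (LinearMap.ker T).map (φ.idealSpace α).subtype ≤ φ.idealSpace α := by
      rintro _ ⟨w, -, rfl⟩; exact w.2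
    rcases eq_bot_or_idealSpace_le hle (by
      rintro a _ ⟨w, hw, rfl⟩
      refine ⟨⟨_, lie_mem_idealSpace (φ := φ) (a : GroupLieAlgebra 𝓘(ℝ, E) G) w.2⟩, ?_, rfl⟩
      rw [SetLike.mem_coe, LinearMap.mem_ker] at hw ⊢
      have := hT.map_lie isInvariant_idealSpace a w
        ⟨_, lie_mem_idealSpace (φ := φ) (a : GroupLieAlgebra 𝓘(ℝ, E) G) w.2⟩ rfl
      apply Subtype.ext
      refine this.trans ?_
      rw [LinearMap.comp_apply, hw, map_zero, lie_zero_right]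
      rfl) with h | h
    · exact (Submodule.map_injective_of_injective (Submodule.subtype_injective _))
        (h.trans (Submodule.map_bot _).symm)
    · refine absurd ?_ h0
      ext1 w
      obtain ⟨w', hw', e⟩ := h w.2
      rw [← Subtype.ext e]
      exact hw'
  have hrange : LinearMap.range T = ⊤ := by
    let R : Subrepresentation W.toRepresentation :=
      { toSubmodule := LinearMap.range T
        apply_mem_toSubmodule := by
          rintro g _ ⟨w, rfl⟩
          refine ⟨⟨_, isInvariant_idealSpace g w w.2⟩, ?_⟩
          apply Subtype.ext
          exact hT g w _ rfl }
    have hs : IsSimpleOrder (Subrepresentation W.toRepresentation) := hW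
    rcases hs.eq_bot_or_eq_top R with h | h
    · refine absurd (LinearMap.range_eq_bot.1 ?_) h0
      exact congrArg Subrepresentation.toSubmodule h
    · exact congrArg Subrepresentation.toSubmodule h
  exact ⟨⟨LinearEquiv.ofBijective T ⟨LinearMap.ker_eq_bot.1 hker, LinearMap.range_eq_top.1 hrange⟩,
    hT⟩⟩

theorem Intertwines.starProjection_comp {N M : Submodule ℝ (SkewOp V)} (hM : φ.IsInvariant M)
    {T : N →ₗ[ℝ] SkewOp V} (hT : φ.Intertwines T) :
    φ.Intertwines ((M.starProjection : SkewOp V →ₗ[ℝ] SkewOp V) ∘ₗ T) := fun g w w' hw => by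
  simp only [LinearMap.comp_apply, ContinuousLinearMap.coe_coe, hT g w w' hw,
    hM.starProjection_conjRep]

/-- By Schur, T has no part in a W_κ not isomorphic to W_α, and by assumption none in the isomorphic
ones. Its values thus lie in dφ(𝔤) and are orthogonal to W_α, where only the zero intertwiner
exists. -/
theorem Intertwines.eq_zero_of_orthogonal [ConnectedSpace G] {K : Type*}
    {W : K → Subrepresentation φ.conjRep} (hW : φ.IsComplementDecomposition W)
    {T : φ.idealSpace α →ₗ[ℝ] SkewOp V} (hT : φ.Intertwines T)
    (h₁ : ∀ w, T w ∈ (φ.idealSpace α)ᗮ)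
    (h₂ : ∀ κ, φ.Iso (W κ).toSubmodule (φ.idealSpace α) → ∀ w, T w ∈ (W κ).toSubmoduleᗮ) :
    T = 0 := by
  refine hT.eq_zero_of_mem_range (fun w => ?_) h₁
  rw [← Submodule.orthogonal_orthogonal (LinearMap.range φ.dφ), ← hW.iSup_eq,
    Submodule.mem_orthogonal]
  suffices h : ⨆ κ, (W κ).toSubmodule ≤ (Submodule.span ℝ {T w})ᗮ by
    intro u hu
    exact Submodule.mem_orthogonal_singleton_iff_inner_left.1 (h hu)
  refine iSup_le fun κ => ?_
  have h : T w ∈ (W κ).toSubmoduleᗮ := by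
    rcases Intertwines.eq_zero_or_iso (W κ) (hW.irreducible κ)
      (((W κ).toSubmodule.orthogonalProjectionOnto : SkewOp V →ₗ[ℝ] (W κ).toSubmodule) ∘ₗ T)
      (hT.starProjection_comp (isInvariant_toSubmodule (W κ))) with h | h
    · have := LinearMap.congr_fun h w
      simp only [LinearMap.comp_apply, ContinuousLinearMap.coe_coe, LinearMap.zero_apply] at this
      exact Submodule.orthogonalProjectionOnto_eq_zero_iff.1 this
    · exact h₂ κ h w
  intro u hu
  rw [Submodule.mem_orthogonal_singleton_iff_inner_left]
  exact Submodule.inner_right_of_mem_orthogonal hu h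

/-! ### Isometric parametrisations of the components isomorphic to a simple ideal -/

variable (φ α) in
/-- An isometric `G`-isomorphism from `dφ(𝔤_α)` onto a component. -/
structure Param (W : Submodule ℝ (SkewOp V)) where
  σ : φ.idealSpace α ≃ₗ[ℝ] W
  inner_map_map : ∀ w w', ⟪σ w, σ w'⟫_ℝ = ⟪w, w'⟫_ℝ
  equivariant : ∀ (g : G) (w w' : φ.idealSpace α), (w' : SkewOp V) = φ.conjRep g w →
    (σ w' : SkewOp V) = φ.conjRep g (σ w)

variable (φ α) in
/-- The identity parametrisation. -/
def Param.refl : φ.Param α (φ.idealSpace α) where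
  σ := LinearEquiv.refl ℝ _
  inner_map_map _ _ := rfl
  equivariant _ _ _ hw := hw

/-- The `G`-isomorphism underlying a parametrisation. -/
def Param.toGIso {W : Submodule ℝ (SkewOp V)} (p : φ.Param α W) : φ.GIso (φ.idealSpace α) W where
  γ := p.σ
  equivariant := p.equivariant

/-- The operator γ†γ commutes with G, so it is a scalar c, positive unless the space is zero.
Dividing γ by √c gives an isometry. -/
theorem GIso.nonempty_param [ConnectedSpace G] {W : Submodule ℝ (SkewOp V)}
    (e : φ.GIso (φ.idealSpace α) W) : Nonempty (φ.Param α W) := by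
  have hW := e.isInvariant isInvariant_idealSpace
  let γ : φ.idealSpace α →ₗ[ℝ] W := e.γ
  have hγ : ∀ (g : G) (w w' : φ.idealSpace α), (w' : SkewOp V) = φ.conjRep g w →
    (γ w' : SkewOp V) = φ.conjRep g (γ w) := e.equivariant
  obtain ⟨c, hc⟩ := Intertwines.exists_eq_smul (LinearMap.adjoint γ ∘ₗ γ) (by
    intro g w w' hw
    change ((LinearMap.adjoint γ (γ w') : φ.idealSpace α) : SkewOp V) =
      φ.conjRep g (LinearMap.adjoint γ (γ w) : φ.idealSpace α)
    have h : LinearMap.adjoint γ (γ w') =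
        ⟨_, isInvariant_idealSpace g _ (LinearMap.adjoint γ (γ w)).2⟩ := by
      refine ext_inner_right ℝ fun z => ?_
      let z' : φ.idealSpace α := ⟨_, isInvariant_idealSpace g⁻¹ _ z.2⟩
      rw [LinearMap.adjoint_inner_left, Submodule.coe_inner, Submodule.coe_inner,
        inner_conjRep_left, hγ g w w' hw, inner_conjRep_left, ← hγ g⁻¹ z z' rfl]
      change _ = ⟪((LinearMap.adjoint γ (γ w) : φ.idealSpace α) : SkewOp V), (z' : SkewOp V)⟫_ℝ
      rw [← Submodule.coe_inner, ← Submodule.coe_inner]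
      exact (LinearMap.adjoint_inner_left γ z' (γ w)).symm
    rw [h])
  have hinner : ∀ w w', ⟪γ w, γ w'⟫_ℝ = c * ⟪w, w'⟫_ℝ := by
    intro w w'
    rw [← LinearMap.adjoint_inner_left, ← inner_smul_left_coe, ← hc w, LinearMap.comp_apply]
  obtain ⟨r, hr, hr'⟩ : ∃ r : ℝ, r ≠ 0 ∧ ∀ w w', ⟪γ w, γ w'⟫_ℝ = r ^ 2 * ⟪w, w'⟫_ℝ := by
    rcases subsingleton_or_nontrivial (φ.idealSpace α) with hs | hs
    · refine ⟨1, one_ne_zero, fun w w' => ?_⟩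
      rw [Subsingleton.elim w 0, map_zero, inner_zero_left, inner_zero_left, mul_zero]
    · obtain ⟨w, hw⟩ := exists_ne (0 : φ.idealSpace α)
      have h1 : 0 < ⟪γ w, γ w⟫_ℝ := real_inner_self_pos.2 fun h => hw (e.γ.map_eq_zero_iff.1 h)
      have h2 : 0 < ⟪w, w⟫_ℝ := real_inner_self_pos.2 hw
      have hc0 : 0 < c := by
        rw [hinner] at h1
        exact (pos_iff_pos_of_mul_pos h1).2 h2
      refine ⟨Real.sqrt c, (Real.sqrt_pos.2 hc0).ne', fun w w' => ?_⟩
      rw [Real.sq_sqrt hc0.le, hinner]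
  have hr0 : r⁻¹ ≠ 0 := inv_ne_zero hr
  refine ⟨⟨e.γ.trans (LinearEquiv.smulOfNeZero ℝ W r⁻¹ hr0), fun w w' => ?_, ?_⟩⟩
  · change ⟪r⁻¹ • γ w, r⁻¹ • γ w'⟫_ℝ = ⟪w, w'⟫_ℝ
    rw [inner_smul_left_coe, inner_smul_right_coe, hr']
    field_simp
  · intro g w w' hw
    change ((r⁻¹ • γ w' : W) : SkewOp V) = φ.conjRep g (r⁻¹ • γ w : W)
    rw [Submodule.coe_smul, Submodule.coe_smul, map_smul,
      hγ g w w' hw]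

theorem Param.exists_smul [ConnectedSpace G] {W₁ W₂ : Submodule ℝ (SkewOp V)} (p₁ : φ.Param α W₁)
    (p₂ : φ.Param α W₂) (e : φ.GIso W₂ W₁) :
    ∃ c : ℝ, c ≠ 0 ∧ ∀ w, e.γ (p₂.σ w) = c • p₁.σ w := by
  let f := (p₂.toGIso.trans e).trans (p₁.toGIso.symm isInvariant_idealSpace)
  obtain ⟨c, hc⟩ := Intertwines.exists_eq_smul (f.γ : φ.idealSpace α →ₗ[ℝ] φ.idealSpace α)
    f.intertwines
  have h : ∀ w, e.γ (p₂.σ w) = c • p₁.σ w := by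
    intro w
    have := congrArg p₁.σ (hc w)
    rw [map_smul] at this
    rw [← this]
    exact (p₁.σ.apply_symm_apply _).symm
  rcases subsingleton_or_nontrivial (φ.idealSpace α) with hs | hs
  · exact ⟨1, one_ne_zero, fun w => by rw [Subsingleton.elim w 0]; simp⟩
  · refine ⟨c, ?_, h⟩
    rintro rfl
    obtain ⟨w, hw⟩ := exists_ne (0 : φ.idealSpace α)
    have := h w
    rw [zero_smul, e.γ.map_eq_zero_iff, p₂.σ.map_eq_zero_iff] at this
    exact hw this

/-- The component in `W`, transported to `dφ(𝔤_α)`. -/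
def Param.coord {W : Submodule ℝ (SkewOp V)} (p : φ.Param α W) : SkewOp V →ₗ[ℝ] φ.idealSpace α :=
  (p.σ.symm : W →ₗ[ℝ] φ.idealSpace α) ∘ₗ
    (W.orthogonalProjectionOnto : SkewOp V →ₗ[ℝ] W)

theorem Param.σ_coord {W : Submodule ℝ (SkewOp V)} (p : φ.Param α W) (X : SkewOp V) :
    p.σ (p.coord X) = W.orthogonalProjectionOnto X :=
  p.σ.apply_symm_apply _

/-- The operator `w ↦ σ⁻¹ P_W [X, σ w]` on `dφ(𝔤_α)`. -/
def Param.adCoord {W : Submodule ℝ (SkewOp V)} (p : φ.Param α W) (X : SkewOp V) :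
    φ.idealSpace α →ₗ[ℝ] φ.idealSpace α :=
  p.coord ∘ₗ ad X ∘ₗ W.subtype ∘ₗ (p.σ : φ.idealSpace α →ₗ[ℝ] W)

theorem Param.σ_adCoord {W : Submodule ℝ (SkewOp V)} (p : φ.Param α W) (X : SkewOp V)
    (w : φ.idealSpace α) :
    p.σ (p.adCoord X w) = W.orthogonalProjectionOnto ⁅X, (p.σ w : SkewOp V)⁆ :=
  p.σ_coord _

/-- Inverting turns c into c⁻¹, and the adjoint of an isometry is its inverse. The reciprocal
scalars are what makes the correlation quantities independent of γ. -/
theorem Param.invAdjoint_eq {W₁ W₂ : Submodule ℝ (SkewOp V)}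
    (p₁ : φ.Param α W₁) (p₂ : φ.Param α W₂) (e : φ.GIso W₂ W₁) {c : ℝ} (hc : c ≠ 0)
    (h : ∀ w, e.γ (p₂.σ w) = c • p₁.σ w) (w : φ.idealSpace α) :
    e.invAdjoint (p₂.σ w) = c⁻¹ • p₁.σ w := by
  refine ext_inner_right ℝ fun z => ?_
  obtain ⟨z, rfl⟩ := p₁.σ.surjective z
  have h' : e.γ.symm (p₁.σ z) = c⁻¹ • p₂.σ z := by
    rw [LinearEquiv.symm_apply_eq, map_smul, h, smul_smul, inv_mul_cancel₀ hc, one_smul]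
  rw [GIso.invAdjoint, LinearMap.adjoint_inner_left, LinearEquiv.coe_coe, h', inner_smul_left_coe,
    inner_smul_right_coe, p₂.inner_map_map, p₁.inner_map_map]

theorem Param.corrFrob_eq [ConnectedSpace G] {W₁ W₂ : Submodule ℝ (SkewOp V)}
    (p₁ : φ.Param α W₁) (p₂ : φ.Param α W₂) (e : φ.GIso W₂ W₁) (B C : Observable V) :
    e.corrFrob B C = ⟪p₁.coord (ofObs B), p₂.coord (ofObs B)⟫_ℝ *
      ⟪p₁.coord (ofObs C), p₂.coord (ofObs C)⟫_ℝ := by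
  obtain ⟨c, hc, h⟩ := p₁.exists_smul p₂ e
  simp only [GIso.corrFrob, ← Param.σ_coord p₁, ← Param.σ_coord p₂, h, p₁.invAdjoint_eq p₂ e hc h,
    inner_smul_right_coe, p₁.inner_map_map]
  field_simp

theorem Param.corrKill_eq [ConnectedSpace G] {W₁ W₂ : Submodule ℝ (SkewOp V)}
    (p₁ : φ.Param α W₁) (p₂ : φ.Param α W₂) (e : φ.GIso W₂ W₁)
    (u : OrthonormalBasis (Fin (finrank ℝ W₁)) ℝ W₁)
    (v : OrthonormalBasis (Fin (finrank ℝ W₂)) ℝ W₂) (A : Observable V) :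
    e.corrKill u v A = LinearMap.trace ℝ _
      (LinearMap.adjoint (p₁.adCoord (ofObs A)) ∘ₗ p₂.adCoord (ofObs A)) := by
  obtain ⟨c, hc, h⟩ := p₁.exists_smul p₂ e
  let w := v.map (p₂.σ.isometryOfInner p₂.inner_map_map).symm
  have hv : ∀ k, v k = p₂.σ (w k) := fun k =>
    ((p₂.σ.isometryOfInner p₂.inner_map_map).apply_symm_apply (v k)).symm
  rw [LinearMap.trace_eq_sum_inner _ w, GIso.corrKill, Finset.sum_comm]
  refine Finset.sum_congr rfl fun k _ => ?_
  let f : W₁ →ₗ[ℝ] W₁ := (W₁.orthogonalProjectionOnto : SkewOp V →ₗ[ℝ] W₁) ∘ₗ ad (ofObs A) ∘ₗ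
    W₁.subtype
  have hf : ∀ y : W₁, W₁.orthogonalProjectionOnto ⁅ofObs A, (y : SkewOp V)⁆ = f y := fun _ => rfl
  -- Expanding y in the basis u removes the sum over j and all dependence on u. The remaining sum
  -- over k is a trace in the transported basis w.
  have hsum : ∀ y z : W₁, ∑ j, ⟪u j, y⟫_ℝ * ⟪f (u j), z⟫_ℝ = ⟪f y, z⟫_ℝ := by
    intro y z
    conv_rhs => rw [← u.sum_repr' y, map_sum, sum_inner]
    refine Finset.sum_congr rfl fun j _ => ?_
    rw [map_smul, inner_smul_left_coe]
  simp only [hf]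
  rw [hsum, hv k, p₁.invAdjoint_eq p₂ e hc h, ← Param.σ_adCoord, h, map_smul, ← hf,
    ← Param.σ_adCoord, inner_smul_left_coe, inner_smul_right_coe, p₁.inner_map_map,
    LinearMap.comp_apply, LinearMap.adjoint_inner_right]
  field_simp

end UnitaryRep

/-! ### Correlation quantities in coordinates and the Killing norm -/

namespace SkewOp

variable {V : Type*} [NormedAddCommGroup V] [InnerProductSpace ℂ V] [FiniteDimensional ℂ V]

theorem ofObs_toObs (X : SkewOp V) : ofObs X.toObs = -X := op_injective (by
  change Complex.I • Complex.I • op X = op (-X)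
  rw [smul_smul, Complex.I_mul_I, map_neg, neg_one_smul])

end SkewOp

namespace UnitaryRep

variable {E : Type*} [NormedAddCommGroup E] [NormedSpace ℝ E] [FiniteDimensional ℝ E]
  {G : Type*} [TopologicalSpace G] [ChartedSpace E G] [Group G] [LieGroup 𝓘(ℝ, E) ∞ G]
  {V : Type*} [NormedAddCommGroup V] [InnerProductSpace ℂ V] [FiniteDimensional ℂ V]
  {φ : UnitaryRep E G V} {α : SimpleIdeal (GroupLieAlgebra 𝓘(ℝ, E) G)}

theorem Param.iso [ConnectedSpace G] {W₁ W₂ : Submodule ℝ (SkewOp V)}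
    (p₁ : φ.Param α W₁) (p₂ : φ.Param α W₂) : φ.Iso W₁ W₂ :=
  ⟨(p₂.toGIso.symm isInvariant_idealSpace).trans p₁.toGIso⟩

theorem Param.corrFrob_rep_eq [ConnectedSpace G] {W₁ W₂ : Submodule ℝ (SkewOp V)}
    (p₁ : φ.Param α W₁) (p₂ : φ.Param α W₂) (B C : Observable V) :
    φ.corrFrob W₁ W₂ B C = ⟪p₁.coord (ofObs B), p₂.coord (ofObs B)⟫_ℝ *
      ⟪p₁.coord (ofObs C), p₂.coord (ofObs C)⟫_ℝ := by
  rw [UnitaryRep.corrFrob, dif_pos (p₁.iso p₂), p₁.corrFrob_eq p₂]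

theorem Param.corrKill_rep_eq [ConnectedSpace G] {W₁ W₂ : Submodule ℝ (SkewOp V)}
    (p₁ : φ.Param α W₁) (p₂ : φ.Param α W₂) (A : Observable V) :
    φ.corrKill W₁ W₂ A = LinearMap.trace ℝ _
      (LinearMap.adjoint (p₁.adCoord (ofObs A)) ∘ₗ p₂.adCoord (ofObs A)) := by
  rw [UnitaryRep.corrKill, dif_pos (p₁.iso p₂), p₁.corrKill_eq p₂]

theorem Param.compNormSq_eq {W : Submodule ℝ (SkewOp V)} (p : φ.Param α W) (A : Observable V) :
    compNormSq W A = ⟪p.coord (ofObs A), p.coord (ofObs A)⟫_ℝ := by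
  rw [← p.inner_map_map, p.σ_coord, real_inner_self_eq_norm_sq]
  rfl

theorem exists_param_of_mem_dlaComponents [ConnectedSpace G] {K : Type*}
    {W : K → Subrepresentation φ.conjRep} {W₁ : Submodule ℝ (SkewOp V)}
    (h : W₁ ∈ dlaComponents W α) : Nonempty (φ.Param α W₁) := by
  rcases h with rfl | ⟨κ, ⟨e⟩, rfl⟩
  · exact ⟨Param.refl φ α⟩
  · exact e.nonempty_param

theorem iso_and_corr_eq_of_mem_dlaComponents [ConnectedSpace G] {K : Type*}
    {W : K → Subrepresentation φ.conjRep} {W₁ W₂ : Submodule ℝ (SkewOp V)}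
    (h₁ : W₁ ∈ dlaComponents W α) (h₂ : W₂ ∈ dlaComponents W α) :
    φ.Iso W₁ W₂ ∧ ∀ e : φ.GIso W₂ W₁,
      (∀ B C, e.corrFrob B C = φ.corrFrob W₁ W₂ B C) ∧
      (∀ u v A, e.corrKill u v A = φ.corrKill W₁ W₂ A) := by
  obtain ⟨p₁⟩ := exists_param_of_mem_dlaComponents h₁
  obtain ⟨p₂⟩ := exists_param_of_mem_dlaComponents h₂
  refine ⟨p₁.iso p₂, fun e => ⟨fun B C => ?_, fun u v A => ?_⟩⟩
  · rw [p₁.corrFrob_eq p₂, p₁.corrFrob_rep_eq p₂]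
  · rw [p₁.corrKill_eq p₂, p₁.corrKill_rep_eq p₂]

variable (φ α) in
/-- The adjoint action of `𝔤` on `dφ(𝔤_α)`. -/
def adIdeal (h : GroupLieAlgebra 𝓘(ℝ, E) G) : φ.idealSpace α →ₗ[ℝ] φ.idealSpace α :=
  (ad (φ.dφ h)).restrict fun _ hX => lie_mem_idealSpace h hX

theorem coe_adIdeal (h : GroupLieAlgebra 𝓘(ℝ, E) G) (w : φ.idealSpace α) :
    (φ.adIdeal α h w : SkewOp V) = ⁅φ.dφ h, (w : SkewOp V)⁆ := rfl

theorem adjoint_adIdeal (h : GroupLieAlgebra 𝓘(ℝ, E) G) :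
    LinearMap.adjoint (φ.adIdeal α h) = -φ.adIdeal α h := by
  symm
  rw [LinearMap.eq_adjoint_iff]
  intro x y
  rw [Submodule.coe_inner, Submodule.coe_inner, LinearMap.neg_apply, Submodule.coe_neg,
    inner_neg_left, coe_adIdeal, coe_adIdeal, inner_lie_left, neg_neg]

theorem Param.σ_adIdeal [ConnectedSpace G] {W : Submodule ℝ (SkewOp V)} (p : φ.Param α W)
    (h : GroupLieAlgebra 𝓘(ℝ, E) G) (w : φ.idealSpace α) :
    (p.σ (φ.adIdeal α h w) : SkewOp V) = ⁅φ.dφ h, (p.σ w : SkewOp V)⁆ :=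
  p.toGIso.intertwines.map_lie isInvariant_idealSpace h w _ rfl

theorem Param.adCoord_ofObs_toObs [ConnectedSpace G] {W : Submodule ℝ (SkewOp V)}
    (p : φ.Param α W) (h : GroupLieAlgebra 𝓘(ℝ, E) G) :
    p.adCoord (ofObs (φ.dφ h).toObs) = -φ.adIdeal α h := by
  ext1 w
  apply p.σ.injective
  rw [p.σ_adCoord, ofObs_toObs, LinearMap.neg_apply, map_neg,
    show ⁅-φ.dφ h, (p.σ w : SkewOp V)⁆ = ((-p.σ (φ.adIdeal α h w) : W) : SkewOp V) by
      rw [Submodule.coe_neg, p.σ_adIdeal, ← ad_apply, map_neg]; rfl,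
    orthogonalProjectionOnto_coe]

/-- Each component carries the same adjoint action, so the value does not depend on the pair of
components. The sign from i(iH) = -H occurs twice and cancels. -/
theorem Param.corrKill_toObs [ConnectedSpace G] {W₁ W₂ : Submodule ℝ (SkewOp V)}
    (p₁ : φ.Param α W₁) (p₂ : φ.Param α W₂) (h : GroupLieAlgebra 𝓘(ℝ, E) G) :
    φ.corrKill W₁ W₂ (φ.dφ h).toObs =
      LinearMap.trace ℝ _ (LinearMap.adjoint (φ.adIdeal α h) ∘ₗ φ.adIdeal α h) := by
  rw [p₁.corrKill_rep_eq p₂, p₁.adCoord_ofObs_toObs, p₂.adCoord_ofObs_toObs, map_neg,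
    LinearMap.neg_comp, LinearMap.comp_neg, neg_neg]

theorem idealMap_injective (hα : φ.idealSpace α ≠ ⊥) : Function.Injective (φ.idealMap α) := by
  let I : LieIdeal ℝ α.1 :=
    { LinearMap.ker (φ.idealMap α) with
      lie_mem := fun {a b} hb => by
        change φ.dφ (⁅a, b⁆ : α.1) = 0
        have hb' : φ.dφ (b : GroupLieAlgebra 𝓘(ℝ, E) G) = 0 := hb
        rw [LieIdeal.coe_bracket_of_module, LieSubmodule.coe_bracket, dφ_lie, hb', lie_zero_right] }
  have hI : ∀ a : α.1, a ∈ I ↔ φ.idealMap α a = 0 := fun a => Iff.rfl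
  rw [← LinearMap.ker_eq_bot, Submodule.eq_bot_iff]
  rcases α.2.eq_bot_or_eq_top I with h | h
  · intro a ha
    have := (hI a).2 ha
    rwa [h, LieSubmodule.mem_bot] at this
  · refine absurd ?_ hα
    rw [Submodule.eq_bot_iff]
    intro X hX
    obtain ⟨a, rfl⟩ := mem_idealSpace.1 hX
    exact (hI a).1 (h ▸ LieSubmodule.mem_top a)

/-- `dφ` as an isomorphism from a simple ideal onto its image. -/
def idealEquiv (hα : φ.idealSpace α ≠ ⊥) : α.1 ≃ₗ[ℝ] φ.idealSpace α :=
  LinearEquiv.ofBijective ((φ.idealMap α).codRestrict _ fun a => dφ_mem_idealSpace a)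
    ⟨fun _ _ h => idealMap_injective hα (congrArg Subtype.val h), fun X => by
      obtain ⟨a, ha⟩ := mem_idealSpace.1 X.2
      exact ⟨a, Subtype.ext ha⟩⟩

theorem coe_idealEquiv (hα : φ.idealSpace α ≠ ⊥) (a : α.1) :
    (idealEquiv hα a : SkewOp V) = φ.dφ a := rfl

theorem finrank_idealSpace (hα : φ.idealSpace α ≠ ⊥) : finrank ℝ (φ.idealSpace α) = α.dim :=
  (idealEquiv hα).finrank_eq.symm

/-- The difference H - dφ(a) lies in dφ(𝔤) and is orthogonal to W_α, so it commutes with W_α. Hence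
dφ conjugates ad a to ad H on W_α, and skewness of ad H turns -Tr(ad a ad a) into Tr(ad_H† ad_H). -/
theorem killingNormSq_dφ (hα : φ.idealSpace α ≠ ⊥) (h : GroupLieAlgebra 𝓘(ℝ, E) G) :
    φ.killingNormSq α (φ.dφ h) =
      LinearMap.trace ℝ _ (LinearMap.adjoint (φ.adIdeal α h) ∘ₗ φ.adIdeal α h) := by
  let a : α.1 := Function.invFun (fun a : α.1 => φ.dφ a)
    ((φ.idealSpace α).orthogonalProjectionOnto (φ.dφ h) : SkewOp V)
  change -killingForm ℝ α.1 a a = _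
  have ha : φ.dφ a = ((φ.idealSpace α).orthogonalProjectionOnto (φ.dφ h) : SkewOp V) :=
    Function.invFun_eq (f := fun a : α.1 => φ.dφ a)
      (mem_idealSpace.1 ((φ.idealSpace α).orthogonalProjectionOnto (φ.dφ h)).2)
  have hconj : (idealEquiv hα).conj (LieAlgebra.ad ℝ α.1 a) = φ.adIdeal α h := by
    ext1 w
    obtain ⟨b, rfl⟩ := (idealEquiv hα).surjective w
    rw [LinearEquiv.conj_apply_apply, LinearEquiv.symm_apply_apply]
    apply Subtype.ext
    rw [coe_adIdeal, coe_idealEquiv, coe_idealEquiv, LieAlgebra.ad_apply,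
      LieIdeal.coe_bracket_of_module, LieSubmodule.coe_bracket, dφ_lie, ← sub_eq_zero,
      ← lie_sub_left, ← neg_lie_swap, neg_eq_zero]
    refine lie_eq_zero_of_mem_range_of_mem_orthogonal (dφ_mem_idealSpace b)
      (sub_mem ⟨_, rfl⟩ ⟨_, rfl⟩) ?_
    rw [ha, ← neg_sub]
    exact neg_mem (Submodule.sub_starProjection_mem_orthogonal _)
  rw [killingForm_apply_apply, ← LinearMap.trace_conj' _ (idealEquiv hα), LinearEquiv.conj_comp,
    hconj, adjoint_adIdeal, LinearMap.neg_comp, map_neg]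

end UnitaryRep

/-! ### Integration over compact groups -/

theorem integrable_of_continuous_of_compactSpace {X F : Type*} [TopologicalSpace X]
    [CompactSpace X] [MeasurableSpace X] [OpensMeasurableSpace X] [NormedAddCommGroup F]
    (ν : Measure X) [IsFiniteMeasure ν] {f : X → F} (hf : Continuous f) : Integrable f ν :=
  hf.integrable_of_hasCompactSupport (HasCompactSupport.of_compactSpace f)

/-- A left-invariant probability measure on a compact group is invariant under inversion. -/
theorem integral_comp_inv_of_compactSpace {G : Type*} [TopologicalSpace G] [Group G]
    [IsTopologicalGroup G] [CompactSpace G] [SecondCountableTopology G] [MeasurableSpace G]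
    [BorelSpace G] (μ : Measure G) [μ.IsMulLeftInvariant] [IsProbabilityMeasure μ]
    {f : G → ℝ} (hf : Continuous f) : ∫ g, f g⁻¹ ∂μ = ∫ g, f g ∂μ := by
  -- The double integral of f(x⁻¹y) is computed in both orders. Left invariance in y gives ∫ f, and
  -- left invariance in x gives ∫ f(g⁻¹).
  have h1 : ∫ x, ∫ y, f (x⁻¹ * y) ∂μ ∂μ = ∫ g, f g ∂μ := by
    simp only [integral_mul_left_eq_self]
    simp
  have h2 : ∫ y, ∫ x, f (x⁻¹ * y) ∂μ ∂μ = ∫ g, f g⁻¹ ∂μ := by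
    have : ∀ y, ∫ x, f (x⁻¹ * y) ∂μ = ∫ x, f x⁻¹ ∂μ := fun y => by
      rw [← integral_mul_left_eq_self (fun x => f x⁻¹) y⁻¹]
      simp
    simp only [this]
    simp
  rw [← h1, ← h2]
  refine (integral_integral_swap ?_).symm
  exact integrable_of_continuous_of_compactSpace _ (by fun_prop)

/-- Bessel's inequality for continuous functions on a compact space. -/
theorem sum_integral_mul_self_le {X ι : Type*} [TopologicalSpace X] [CompactSpace X]
    [MeasurableSpace X] [OpensMeasurableSpace X] (ν : Measure X) [IsFiniteMeasure ν] [Fintype ι]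
    {f : X → ℝ} {F : ι → X → ℝ} (hf : Continuous f) (hF : ∀ i, Continuous (F i))
    (h₁ : ∀ i, ∫ x, f x * F i x ∂ν = ∫ x, F i x * F i x ∂ν)
    (h₂ : ∀ i j, i ≠ j → ∫ x, F i x * F j x ∂ν = 0) :
    ∑ i, ∫ x, F i x * F i x ∂ν ≤ ∫ x, f x * f x ∂ν := by
  have hI : ∀ {u : X → ℝ}, Continuous u → Integrable u ν := fun hu =>
    integrable_of_continuous_of_compactSpace ν hu
  have e : ∀ x, (f x - ∑ i, F i x) * (f x - ∑ i, F i x) =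
      f x * f x - 2 * (∑ i, f x * F i x) + ∑ i, ∑ j, F i x * F j x := by
    intro x
    rw [← Finset.mul_sum, ← Finset.sum_mul_sum]
    ring
  -- Nonnegativity of the squared norm of f - Σ F_i, expanded, is the claim.
  have h0 : 0 ≤ ∫ x, (f x - ∑ i, F i x) * (f x - ∑ i, F i x) ∂ν :=
    integral_nonneg fun x => mul_self_nonneg _
  simp only [e] at h0
  rw [integral_add (hI (by fun_prop)) (hI (by fun_prop)),
    integral_sub (hI (by fun_prop)) (hI (by fun_prop)), integral_const_mul,
    integral_finsetSum _ (fun i _ => hI (by fun_prop)),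
    integral_finsetSum _ (fun i _ => hI (by fun_prop))] at h0
  have e2 : ∀ i, ∫ x, ∑ j, F i x * F j x ∂ν = ∫ x, F i x * F i x ∂ν := by
    intro i
    rw [integral_finsetSum _ (fun j _ => hI (by fun_prop))]
    exact Finset.sum_eq_single_of_mem i (Finset.mem_univ i) fun j _ hj => h₂ i j hj.symm
  simp only [e2, h₁] at h0
  linarith

/-! ### The gradient as a pairing on G × G -/

namespace UnitaryRep

variable {E : Type*} [NormedAddCommGroup E] [NormedSpace ℝ E] [FiniteDimensional ℝ E]
  {G : Type*} [TopologicalSpace G] [ChartedSpace E G] [Group G] [LieGroup 𝓘(ℝ, E) ∞ G]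
  {V : Type*} [NormedAddCommGroup V] [InnerProductSpace ℂ V] [FiniteDimensional ℂ V]
  (φ : UnitaryRep E G V) {α : SimpleIdeal (GroupLieAlgebra 𝓘(ℝ, E) G)}

/-- The function `⟪k r, [H, g q]⟫` on `G × G`, where `H = dφ(h)`. -/
def pairing (h : GroupLieAlgebra 𝓘(ℝ, E) G) (q r : SkewOp V) (p : G × G) : ℝ :=
  ⟪φ.conjRep p.2 r, ⁅φ.dφ h, φ.conjRep p.1 q⁆⟫_ℝ

/-- The factor i² = -1 cancels the sign in the Frobenius product. The inverse appears because ρ is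
conjugated by U† rather than by U. -/
theorem abstractGrad_eq_pairing (O A : Observable V) (h : GroupLieAlgebra 𝓘(ℝ, E) G) (g k : G) :
    φ.abstractGrad O A h g k = φ.pairing h (ofObs O) (ofObs A) (g, k⁻¹) := by
  have e : op (φ.conjRep k⁻¹ (ofObs A)) * op ⁅φ.dφ h, φ.conjRep g (ofObs O)⁆ =
      -(star (φ.U k) * (A : V →L[ℂ] V) * φ.U k *
        (op (φ.dφ h) * (φ.U g * (O : V →L[ℂ] V) * star (φ.U g)) -
          (φ.U g * (O : V →L[ℂ] V) * star (φ.U g)) * op (φ.dφ h))) := by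
    rw [op_lie, op_conjRep, op_conjRep, ← star_U, star_star]
    change star (φ.U k) * (Complex.I • (A : V →L[ℂ] V)) * φ.U k *
      (op (φ.dφ h) * (φ.U g * (Complex.I • (O : V →L[ℂ] V)) * star (φ.U g)) -
          (φ.U g * (Complex.I • (O : V →L[ℂ] V)) * star (φ.U g)) * op (φ.dφ h)) = _
    simp only [mul_smul_comm, smul_mul_assoc, ← smul_sub]
    rw [smul_smul, Complex.I_mul_I, neg_one_smul]
  rw [pairing, inner_def, e, tr_neg, Complex.neg_re, neg_neg]
  rfl

theorem continuous_lie (X : SkewOp V) : Continuous fun Y : SkewOp V => ⁅X, Y⁆ :=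
  LinearMap.continuous_of_finiteDimensional (ad X)

theorem continuous_pairing (h : GroupLieAlgebra 𝓘(ℝ, E) G) (q r : SkewOp V) :
    Continuous (φ.pairing h q r) :=
  ((φ.continuous_conjRep r).comp continuous_snd).inner
    ((continuous_lie _).comp ((φ.continuous_conjRep q).comp continuous_fst))

theorem pairing_eq (h : GroupLieAlgebra 𝓘(ℝ, E) G) (q r : SkewOp V) (g k : G) :
    φ.pairing h q r (g, k) = -⟪⁅φ.dφ h, φ.conjRep k r⁆, φ.conjRep g q⟫_ℝ := by
  rw [inner_lie_left, neg_neg]; rfl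

theorem pairing_add_left (h : GroupLieAlgebra 𝓘(ℝ, E) G) (q q' r : SkewOp V) (p : G × G) :
    φ.pairing h (q + q') r p = φ.pairing h q r p + φ.pairing h q' r p := by
  simp only [pairing, map_add, lie_add_right, inner_add_right]

theorem pairing_add_right (h : GroupLieAlgebra 𝓘(ℝ, E) G) (q r r' : SkewOp V) (p : G × G) :
    φ.pairing h q (r + r') p = φ.pairing h q r p + φ.pairing h q r' p := by
  simp only [pairing, map_add, inner_add_left]

variable {φ}

theorem IsInvariant.pairing_eq_zero {N : Submodule ℝ (SkewOp V)} (hN : φ.IsInvariant N)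
    (h : GroupLieAlgebra 𝓘(ℝ, E) G) {q r : SkewOp V} (hq : q ∈ N) (hr : r ∈ Nᗮ) (p : G × G) :
    φ.pairing h q r p = 0 :=
  Submodule.inner_left_of_mem_orthogonal (hN.lie_mem h (hN _ _ hq)) (hN.orthogonal _ _ hr)

theorem inner_conjRep_right (k : G) (X Y : SkewOp V) :
    ⟪X, φ.conjRep k Y⟫_ℝ = ⟪φ.conjRep k⁻¹ X, Y⟫_ℝ := by
  rw [inner_conjRep_left, inv_inv]

/-- The line through X is invariant, so [H, X] is a multiple of X, yet it is orthogonal to X by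
skewness. -/
theorem lie_eq_zero_of_conj_eq {X : SkewOp V} (hX : ∀ g, φ.conjRep g X = X)
    (h : GroupLieAlgebra 𝓘(ℝ, E) G) : ⁅φ.dφ h, X⁆ = 0 := by
  have hN : φ.IsInvariant (ℝ ∙ X) := by
    intro g Y hY
    obtain ⟨c, rfl⟩ := Submodule.mem_span_singleton.mp hY
    rw [map_smul, hX]
    exact hY
  obtain ⟨c, hc⟩ := Submodule.mem_span_singleton.mp
    (hN.lie_mem h (Submodule.mem_span_singleton_self X))
  have h1 : ⟪⁅φ.dφ h, X⁆, X⟫_ℝ = 0 := by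
    have := inner_lie_left (φ.dφ h) X X
    rw [real_inner_comm] at this
    rw [real_inner_comm]
    linarith
  rw [← inner_self_eq_zero (𝕜 := ℝ)]
  nth_rewrite 2 [← hc]
  rw [real_inner_smul_right, h1, mul_zero]

/-! ### Averaged operators and Schur orthogonality -/

section Average

variable [CompactSpace G] [MeasurableSpace G] [BorelSpace G] (μ : Measure G)
  [IsProbabilityMeasure μ]

instance : CompleteSpace (SkewOp V) := FiniteDimensional.complete ℝ _

theorem integrable_smul_conjRep (q₁ q₂ y : SkewOp V) :
    Integrable (fun g => ⟪y, φ.conjRep g q₂⟫_ℝ • φ.conjRep g q₁) μ :=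
  integrable_of_continuous_of_compactSpace μ
    (continuous_smul.comp ((continuous_const.inner (φ.continuous_conjRep q₂)).prodMk
      (φ.continuous_conjRep q₁)))

variable (φ) in
/-- The operator `y ↦ ∫ ⟪y, g q₂⟫ g q₁ dμ(g)`. -/
def avgOp (q₁ q₂ : SkewOp V) : SkewOp V →ₗ[ℝ] SkewOp V where
  toFun y := ∫ g, ⟪y, φ.conjRep g q₂⟫_ℝ • φ.conjRep g q₁ ∂μ
  map_add' y z := by
    simp only [inner_add_left, add_smul]
    exact integral_add (integrable_smul_conjRep μ q₁ q₂ y) (integrable_smul_conjRep μ q₁ q₂ z)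
  map_smul' c y := by
    simp only [real_inner_smul_left, mul_smul, RingHom.id_apply]
    exact integral_smul c _

theorem inner_avgOp (q₁ q₂ x y : SkewOp V) :
    ⟪x, φ.avgOp μ q₁ q₂ y⟫_ℝ = ∫ g, ⟪x, φ.conjRep g q₁⟫_ℝ * ⟪y, φ.conjRep g q₂⟫_ℝ ∂μ := by
  rw [avgOp, LinearMap.coe_mk, AddHom.coe_mk,
    ← integral_inner (integrable_smul_conjRep μ q₁ q₂ y) x]
  refine integral_congr_ae (Filter.Eventually.of_forall fun g => ?_)
  simp only [real_inner_smul_right]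
  ring

theorem avgOp_conjRep [IsTopologicalGroup G] [μ.IsMulLeftInvariant] (q₁ q₂ y : SkewOp V) (k : G) :
    φ.avgOp μ q₁ q₂ (φ.conjRep k y) = φ.conjRep k (φ.avgOp μ q₁ q₂ y) := by
  refine ext_inner_left ℝ fun x => ?_
  rw [inner_conjRep_right, inner_avgOp, inner_avgOp,
    ← integral_mul_left_eq_self
      (fun g => ⟪x, φ.conjRep g q₁⟫_ℝ * ⟪φ.conjRep k y, φ.conjRep g q₂⟫_ℝ) k]
  refine integral_congr_ae (Filter.Eventually.of_forall fun g => ?_)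
  simp only [map_mul, Module.End.mul_apply]
  rw [φ.inner_conjRep, inner_conjRep_right]

theorem avgOp_mem {N : Submodule ℝ (SkewOp V)} (hN : φ.IsInvariant N) {q₁ : SkewOp V}
    (h : q₁ ∈ N) (q₂ y : SkewOp V) : φ.avgOp μ q₁ q₂ y ∈ N := by
  rw [← Submodule.orthogonal_orthogonal N, Submodule.mem_orthogonal]
  intro x hx
  rw [inner_avgOp]
  simp [Submodule.inner_left_of_mem_orthogonal (hN _ _ h) hx]

theorem avgOp_eq_zero {N : Submodule ℝ (SkewOp V)} (hN : φ.IsInvariant N) {q₂ y : SkewOp V}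
    (h : q₂ ∈ N) (hy : y ∈ Nᗮ) (q₁ : SkewOp V) : φ.avgOp μ q₁ q₂ y = 0 := by
  refine ext_inner_left ℝ fun x => ?_
  rw [inner_avgOp, inner_zero_right]
  simp [Submodule.inner_left_of_mem_orthogonal (hN _ _ h) hy]

/-- The Schur orthogonality relation on `dφ(𝔤_α)`. -/
theorem finrank_mul_integral_inner_mul_inner [IsTopologicalGroup G] [ConnectedSpace G]
    [μ.IsMulLeftInvariant] (a b x y : φ.idealSpace α) :
    (finrank ℝ (φ.idealSpace α) : ℝ) * ∫ g, ⟪(x : SkewOp V), φ.conjRep g a⟫_ℝ *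
      ⟪(y : SkewOp V), φ.conjRep g b⟫_ℝ ∂μ = ⟪a, b⟫_ℝ * ⟪x, y⟫_ℝ := by
  let S : φ.idealSpace α →ₗ[ℝ] φ.idealSpace α :=
    (φ.avgOp μ a b).restrict fun y _ => avgOp_mem μ isInvariant_idealSpace a.2 b y
  obtain ⟨c, hc⟩ := Intertwines.exists_eq_smul S (by
    intro g w w' hw
    change φ.avgOp μ a b w' = φ.conjRep g (φ.avgOp μ a b w)
    rw [hw, avgOp_conjRep])
  have h1 : ∀ x y : φ.idealSpace α, ∫ g, ⟪(x : SkewOp V), φ.conjRep g a⟫_ℝ *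
      ⟪(y : SkewOp V), φ.conjRep g b⟫_ℝ ∂μ = c * ⟪x, y⟫_ℝ := by
    intro x y
    rw [← inner_avgOp, ← inner_smul_right_coe, ← hc]
    rfl
  let e := stdOrthonormalBasis ℝ (φ.idealSpace α)
  -- The Schur scalar c is found by a trace: summing over x = y = e_i gives ⟪g·a, g·b⟫ = ⟪a, b⟫
  -- under the integral, while the other evaluation is c times the dimension.
  have h2 : ∑ i, ∫ g, ⟪(e i : SkewOp V), φ.conjRep g a⟫_ℝ *
      ⟪(e i : SkewOp V), φ.conjRep g b⟫_ℝ ∂μ = ⟪a, b⟫_ℝ := by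
    rw [← integral_finsetSum]
    · have : ∀ g, ∑ i, ⟪(e i : SkewOp V), φ.conjRep g a⟫_ℝ * ⟪(e i : SkewOp V), φ.conjRep g b⟫_ℝ =
          ⟪a, b⟫_ℝ := by
        intro g
        let a' : φ.idealSpace α := ⟨_, isInvariant_idealSpace g _ a.2⟩
        let b' : φ.idealSpace α := ⟨_, isInvariant_idealSpace g _ b.2⟩
        have := e.sum_inner_mul_inner a' b'
        rw [Submodule.coe_inner _ a b, ← φ.inner_conjRep g]
        refine Eq.trans ?_ this
        refine Finset.sum_congr rfl fun i _ => ?_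
        rw [real_inner_comm]
        rfl
      simp only [this]
      simp
    · intro i _
      exact integrable_of_continuous_of_compactSpace μ
        ((continuous_const.inner (φ.continuous_conjRep _)).mul
          (continuous_const.inner (φ.continuous_conjRep _)))
  simp only [h1] at h2
  have h3 : ∀ i, ⟪e i, e i⟫_ℝ = 1 := fun i => by
    rw [real_inner_self_eq_norm_sq, e.norm_eq_one]; norm_num
  simp only [h3, mul_one, Finset.sum_const, Finset.card_univ, Fintype.card_fin,
    nsmul_eq_mul] at h2
  rw [h1, ← h2]
  ring

end Average

/-! ### Mean and second moment of the pairing -/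

section Variance

variable [CompactSpace G] [SecondCountableTopology G] [MeasurableSpace G] [BorelSpace G]
  (μ : Measure G) [IsProbabilityMeasure μ]

/-- Integrating over g first isolates an operator that commutes with G, to which Schur's lemma
applies. -/
theorem integral_pairing_mul_pairing (h : GroupLieAlgebra 𝓘(ℝ, E) G) (q₁ r₁ q₂ r₂ : SkewOp V) :
    ∫ p, φ.pairing h q₁ r₁ p * φ.pairing h q₂ r₂ p ∂(μ.prod μ) =
      ∫ k, ⟪⁅φ.dφ h, φ.conjRep k r₁⁆, φ.avgOp μ q₁ q₂ ⁅φ.dφ h, φ.conjRep k r₂⁆⟫_ℝ ∂μ := by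
  have hI : Integrable (fun p => φ.pairing h q₁ r₁ p * φ.pairing h q₂ r₂ p) (μ.prod μ) :=
    integrable_of_continuous_of_compactSpace _
      ((φ.continuous_pairing h q₁ r₁).mul (φ.continuous_pairing h q₂ r₂))
  rw [integral_prod_symm _ hI]
  refine integral_congr_ae (Filter.Eventually.of_forall fun k => ?_)
  simp only [inner_avgOp, pairing_eq, neg_mul_neg]

theorem integral_pairing [IsTopologicalGroup G] [μ.IsMulLeftInvariant]
    (h : GroupLieAlgebra 𝓘(ℝ, E) G) (q r : SkewOp V) :
    ∫ p, φ.pairing h q r p ∂(μ.prod μ) = 0 := by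
  rw [integral_prod_symm _ (integrable_of_continuous_of_compactSpace _
    (φ.continuous_pairing h q r))]
  have hint : Integrable (fun g => φ.conjRep g q) μ :=
    integrable_of_continuous_of_compactSpace μ (φ.continuous_conjRep q)
  -- The average of an orbit is fixed by G, hence commutes with H; this is why the mean vanishes.
  have hinv : ∀ k, φ.conjRep k (∫ g, φ.conjRep g q ∂μ) = ∫ g, φ.conjRep g q ∂μ := by
    intro k
    refine ext_inner_right ℝ fun x => ?_
    rw [inner_conjRep_left, real_inner_comm, real_inner_comm x, ← integral_inner hint,
      ← integral_inner hint, ← integral_mul_left_eq_self (fun g => ⟪x, φ.conjRep g q⟫_ℝ) k]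
    refine integral_congr_ae (Filter.Eventually.of_forall fun g => ?_)
    simp only [map_mul, Module.End.mul_apply, inner_conjRep_right]
  have hlie : ⁅φ.dφ h, ∫ g, φ.conjRep g q ∂μ⁆ = 0 := lie_eq_zero_of_conj_eq hinv h
  have : ∀ k, ∫ g, φ.pairing h q r (g, k) ∂μ = 0 := by
    intro k
    simp only [pairing_eq]
    rw [integral_neg, integral_inner hint, inner_lie_left, hlie, inner_zero_right, neg_zero,
      neg_zero]
  simp only [this, integral_zero]

theorem gradVar_eq [IsTopologicalGroup G] [μ.IsMulLeftInvariant]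
    (O ρ : Observable V) (h : GroupLieAlgebra 𝓘(ℝ, E) G) :
    φ.gradVar μ O ρ h = ∫ p, φ.pairing h (ofObs O) (ofObs ρ) p *
      φ.pairing h (ofObs O) (ofObs ρ) p ∂(μ.prod μ) := by
  set P := φ.pairing h (ofObs O) (ofObs ρ) with hP
  have hc : Continuous P := φ.continuous_pairing h _ _
  have hinv : ∀ u : G × G → ℝ, Continuous u →
      ∫ p, u (p.1, p.2⁻¹) ∂(μ.prod μ) = ∫ p, u p ∂(μ.prod μ) := by
    intro u hu
    rw [integral_prod _ (integrable_of_continuous_of_compactSpace _ (by fun_prop)),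
      integral_prod _ (integrable_of_continuous_of_compactSpace _ hu)]
    refine integral_congr_ae (Filter.Eventually.of_forall fun g => ?_)
    exact integral_comp_inv_of_compactSpace μ (f := fun k => u (g, k)) (by fun_prop)
  have hf : (fun p : G × G => φ.abstractGrad O ρ h p.1 p.2) = fun p => P (p.1, p.2⁻¹) :=
    funext fun p => φ.abstractGrad_eq_pairing O ρ h p.1 p.2
  have hcf : Continuous fun p : G × G => P (p.1, p.2⁻¹) := by fun_prop
  rw [gradVar, hf, variance_eq_sub (hcf.memLp_of_hasCompactSupport
    (HasCompactSupport.of_compactSpace _)), hinv P hc, hP, integral_pairing]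
  simp only [Pi.pow_apply, pow_two, mul_zero, sub_zero]
  exact hinv (fun p => P p * P p) (hc.mul hc)

end Variance

end UnitaryRep

theorem SimpleIdeal.inf_eq_bot {L : Type*} [LieRing L] [LieAlgebra ℝ L] {α β : SimpleIdeal L}
    (h : α ≠ β) : α.1 ⊓ β.1 = ⊥ := by
  rcases SimpleIdeal.inf_eq (J := β.1) α.2 with h1 | h1
  · exact h1
  rcases SimpleIdeal.inf_eq (J := α.1) β.2 with h2 | h2
  · rwa [inf_comm]
  · exact absurd (Subtype.ext (le_antisymm h1 h2)) h

namespace UnitaryRep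

variable {E : Type*} [NormedAddCommGroup E] [NormedSpace ℝ E] [FiniteDimensional ℝ E]
  {G : Type*} [TopologicalSpace G] [ChartedSpace E G] [Group G] [LieGroup 𝓘(ℝ, E) ∞ G]
  {V : Type*} [NormedAddCommGroup V] [InnerProductSpace ℂ V] [FiniteDimensional ℂ V]
  {φ : UnitaryRep E G V} {α β : SimpleIdeal (GroupLieAlgebra 𝓘(ℝ, E) G)}

/-! ### Isotypic components -/

section Isotypic

variable {K : Type*} [Fintype K]

/-- The components isomorphic to `dφ(𝔤_α)`, indexed by `none` (the ideal itself) and the `κ ≅ α`. -/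
def component (W : K → Subrepresentation φ.conjRep)
    (α : SimpleIdeal (GroupLieAlgebra 𝓘(ℝ, E) G)) :
    Option (isoIndices W (φ.idealSpace α)) → Submodule ℝ (SkewOp V)
  | none => φ.idealSpace α
  | some κ => (W κ).toSubmodule

/-- The sum of the components isomorphic to `dφ(𝔤_α)`. -/
def isotypic (W : K → Subrepresentation φ.conjRep)
    (α : SimpleIdeal (GroupLieAlgebra 𝓘(ℝ, E) G)) : Submodule ℝ (SkewOp V) :=
  ⨆ i, component W α i

variable {W : K → Subrepresentation φ.conjRep}

theorem mem_isoIndices {W₀ : Submodule ℝ (SkewOp V)} {κ : K} :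
    κ ∈ isoIndices W W₀ ↔ φ.Iso (W κ).toSubmodule W₀ := by
  simp [isoIndices]

theorem component_mem_dlaComponents (i) : component W α i ∈ dlaComponents W α :=
  match i with
  | none => Or.inl rfl
  | some κ => Or.inr ⟨κ, mem_isoIndices.1 κ.2, rfl⟩

theorem isInvariant_component [ConnectedSpace G] (i) : φ.IsInvariant (component W α i) :=
  match i with
  | none => isInvariant_idealSpace
  | some κ => isInvariant_toSubmodule (W κ)

variable (φ W α) in
/-- A choice of isometric parametrisations of the components. -/
def componentParam [ConnectedSpace G] (i) : φ.Param α (component W α i) :=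
  (exists_param_of_mem_dlaComponents (component_mem_dlaComponents i)).some

theorem IsComplementDecomposition.isOrtho_idealSpace (hW : φ.IsComplementDecomposition W) (κ : K) :
    (W κ).toSubmodule ⟂ φ.idealSpace α :=
  (le_iSup (fun κ => (W κ).toSubmodule) κ).trans (hW.iSup_eq.le.trans
    (Submodule.orthogonal_le (Submodule.map_le_iff_le_comap.2 fun x _ => ⟨x, rfl⟩)))

theorem component_orthogonal (hW : φ.IsComplementDecomposition W) {i j} (hij : i ≠ j) :
    component W α i ⟂ component W α j := by
  match i, j, hij with
  | none, some κ, _ => exact (hW.isOrtho_idealSpace κ).symm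
  | some κ, none, _ => exact hW.isOrtho_idealSpace κ
  | some κ, some κ', h => exact hW.orthogonal fun e => h (congrArg some (Subtype.ext e))

/-- By invariance of the form, ⟪c, [a, b]⟫ = -⟪[a, c], b⟫, and [a, c] lies in the zero intersection
of the two ideals. Brackets span 𝔤_α. -/
theorem idealSpace_orthogonal (h : α ≠ β) : φ.idealSpace α ⟂ φ.idealSpace β := by
  refine idealSpace_le_of_lie_mem fun a b => ?_
  rw [Submodule.mem_orthogonal]
  intro X hX
  obtain ⟨c, rfl⟩ := mem_idealSpace.1 hX
  have h0 : ⁅(a : GroupLieAlgebra 𝓘(ℝ, E) G), (c : GroupLieAlgebra 𝓘(ℝ, E) G)⁆ = 0 := by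
    rw [← LieSubmodule.mem_bot (R := ℝ) (L := GroupLieAlgebra 𝓘(ℝ, E) G),
      ← SimpleIdeal.inf_eq_bot h]
    exact ⟨lie_mem_left ℝ _ α.1 _ _ a.2, β.1.lie_mem c.2⟩
  rw [← neg_neg ⟪_, _⟫_ℝ, ← inner_lie_left, ← dφ_lie, h0, map_zero, inner_zero_left, neg_zero]

theorem component_orthogonal_of_ne [ConnectedSpace G] (hW : φ.IsComplementDecomposition W)
    (h : α ≠ β) (i j) : component W α i ⟂ component W β j := by
  match i, j with
  | none, none => exact idealSpace_orthogonal h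
  | none, some κ => exact (hW.isOrtho_idealSpace κ).symm
  | some κ, none => exact hW.isOrtho_idealSpace κ
  | some κ, some κ' =>
    -- A component isomorphic to both W_α and W_β would give an intertwiner from W_α into W_β. That
    -- map is zero by orthogonality of the two ideals, so the component itself is zero.
    by_cases e : (κ : K) = κ'
    · let p := componentParam φ α W (some κ)
      let p' := componentParam φ β W (some κ')
      obtain ⟨f⟩ : φ.Iso (φ.idealSpace β) (component W α (some κ)) := by
        have : component W α (some κ) = component W β (some κ') :=
          congrArg (fun κ => (W κ).toSubmodule) e
        rw [this]
        exact (Param.refl φ β).iso p'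
      have hT := Intertwines.eq_zero_of_mem_range (p.toGIso.trans f).intertwines
        (fun w => by
          obtain ⟨b, hb⟩ := mem_idealSpace.1 ((p.toGIso.trans f).γ w).2
          exact ⟨b, hb⟩)
        (fun w => idealSpace_orthogonal h.symm ((p.toGIso.trans f).γ w).2)
      have hbot : component W α (some κ) = ⊥ := by
        rw [Submodule.eq_bot_iff]
        intro x hx
        obtain ⟨w, hw⟩ := p.σ.surjective ⟨x, hx⟩
        have h0 : (p.toGIso.trans f).γ w = 0 := Subtype.ext (LinearMap.congr_fun hT w)
        rw [LinearEquiv.map_eq_zero_iff] at h0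
        rw [h0, map_zero] at hw
        exact (congrArg Subtype.val hw).symm
      rw [hbot]
      exact Submodule.isOrtho_bot_left
    · exact hW.orthogonal e

theorem isInvariant_isotypic [ConnectedSpace G] : φ.IsInvariant (isotypic W α) := by
  intro g X hX
  have : isotypic W α ≤ (isotypic W α).comap (φ.conjRep g) :=
    iSup_le fun i x hx => le_iSup (component W α) i (isInvariant_component i g x hx)
  exact this hX

theorem isotypic_orthogonal [ConnectedSpace G] (hW : φ.IsComplementDecomposition W)
    (h : α ≠ β) : isotypic W α ⟂ isotypic W β :=
  Submodule.isOrtho_iSup_left.2 fun i => Submodule.isOrtho_iSup_right.2 fun j =>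
    component_orthogonal_of_ne hW h i j

variable (φ W α) in
/-- The part of `q` in the isotypic component. -/
def isotypicPart [ConnectedSpace G] (q : SkewOp V) : SkewOp V :=
  ∑ i, ((componentParam φ α W i).σ ((componentParam φ α W i).coord q) : SkewOp V)

theorem isotypicPart_mem [ConnectedSpace G] (q : SkewOp V) :
    isotypicPart φ α W q ∈ isotypic W α :=
  Submodule.sum_mem _ fun i _ => le_iSup (component W α) i (Subtype.mem _)

theorem sub_isotypicPart_mem [ConnectedSpace G] (hW : φ.IsComplementDecomposition W)
    (q : SkewOp V) : q - isotypicPart φ α W q ∈ (isotypic W α)ᗮ := by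
  classical
  rw [isotypic, ← Submodule.iInf_orthogonal, Submodule.mem_iInf]
  intro i
  have h : isotypicPart φ α W q = (component W α i).starProjection q +
      ∑ j ∈ Finset.univ.erase i,
        ((componentParam φ α W j).σ ((componentParam φ α W j).coord q) : SkewOp V) := by
    rw [isotypicPart, ← Finset.add_sum_erase _ _ (Finset.mem_univ i), Param.σ_coord]
    rfl
  rw [h, ← sub_sub]
  refine sub_mem (Submodule.sub_starProjection_mem_orthogonal q)
    (Submodule.sum_mem _ fun j hj => ?_)
  exact component_orthogonal hW (Finset.ne_of_mem_erase hj) (Subtype.mem _)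

end Isotypic

/-! ### Correlations of the pairings -/

section Correlation

variable [CompactSpace G] [ConnectedSpace G] [IsTopologicalGroup G] [SecondCountableTopology G]
  [MeasurableSpace G] [BorelSpace G] (μ : Measure G) [IsProbabilityMeasure μ]
  [μ.IsMulLeftInvariant] {K : Type*} [Fintype K] {W : K → Subrepresentation φ.conjRep}

/-- The operator kills the complement of N_α because q₂ lies in N_α. On each component of N_α it is
an intertwiner with values orthogonal to N_α, so Schur's lemma makes it zero there as well. -/
theorem avgOp_eq_zero_of_isotypic (hW : φ.IsComplementDecomposition W) {q₁ q₂ : SkewOp V}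
    (h₁ : q₁ ∈ (isotypic W α)ᗮ) (h₂ : q₂ ∈ isotypic W α) : φ.avgOp μ q₁ q₂ = 0 := by
  have hker : isotypic W α ≤ LinearMap.ker (φ.avgOp μ q₁ q₂) := by
    refine iSup_le fun i x hx => ?_
    let p := componentParam φ α W i
    obtain ⟨w, hw⟩ := p.σ.surjective ⟨x, hx⟩
    have hmem : ∀ y i, φ.avgOp μ q₁ q₂ y ∈ (component W α i)ᗮ := fun y i =>
      Submodule.orthogonal_le (le_iSup (component W α) i)
        (avgOp_mem μ isInvariant_isotypic.orthogonal h₁ q₂ y)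
    have hT := Intertwines.eq_zero_of_orthogonal hW
      (T := φ.avgOp μ q₁ q₂ ∘ₗ (component W α i).subtype ∘ₗ
        (p.σ : φ.idealSpace α →ₗ[ℝ] component W α i))
      (fun g w w' hw => by
        change φ.avgOp μ q₁ q₂ (p.σ w') = φ.conjRep g (φ.avgOp μ q₁ q₂ (p.σ w))
        rw [p.equivariant g w w' hw, avgOp_conjRep])
      (fun w => hmem _ none) (fun κ hκ w => hmem _ (some ⟨κ, mem_isoIndices.2 hκ⟩))
    have := LinearMap.congr_fun hT w
    change φ.avgOp μ q₁ q₂ (p.σ w) = 0 at this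
    rw [hw] at this
    exact this
  ext1 y
  rw [← sub_add_cancel y (isotypicPart φ α W y), map_add,
    avgOp_eq_zero μ isInvariant_isotypic h₂ (sub_isotypicPart_mem hW y), zero_add]
  exact hker (isotypicPart_mem y)

theorem integral_pairing_mul_pairing_eq_zero (hW : φ.IsComplementDecomposition W)
    (h : GroupLieAlgebra 𝓘(ℝ, E) G) {q₁ q₂ : SkewOp V} (h₁ : q₁ ∈ (isotypic W α)ᗮ)
    (h₂ : q₂ ∈ isotypic W α) (r₁ r₂ : SkewOp V) :
    ∫ p, φ.pairing h q₁ r₁ p * φ.pairing h q₂ r₂ p ∂(μ.prod μ) = 0 := by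
  rw [integral_pairing_mul_pairing, avgOp_eq_zero_of_isotypic μ hW h₁ h₂]
  simp

/-- Mixed pairings between N_α and its complement vanish pointwise, since both are stable under
brackets with H. So f is F_α plus a pairing supported on the complement, and the latter is
uncorrelated with F_α. -/
theorem integral_pairing_mul_pairing_isotypicPart (hW : φ.IsComplementDecomposition W)
    (h : GroupLieAlgebra 𝓘(ℝ, E) G) (q r : SkewOp V) :
    ∫ p, φ.pairing h q r p *
        φ.pairing h (isotypicPart φ α W q) (isotypicPart φ α W r) p ∂(μ.prod μ) =
      ∫ p, φ.pairing h (isotypicPart φ α W q) (isotypicPart φ α W r) p *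
        φ.pairing h (isotypicPart φ α W q) (isotypicPart φ α W r) p ∂(μ.prod μ) := by
  set q₀ := isotypicPart φ α W q with hq₀
  set r₀ := isotypicPart φ α W r with hr₀
  have hq : q₀ ∈ isotypic W α := isotypicPart_mem q
  have hr : r₀ ∈ isotypic W α := isotypicPart_mem r
  have hq' : q - q₀ ∈ (isotypic W α)ᗮ := sub_isotypicPart_mem hW q
  have hr' : r - r₀ ∈ (isotypic W α)ᗮ := sub_isotypicPart_mem hW r
  have e : ∀ p, φ.pairing h q r p * φ.pairing h q₀ r₀ p =
      φ.pairing h q₀ r₀ p * φ.pairing h q₀ r₀ p +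
        φ.pairing h (q - q₀) (r - r₀) p * φ.pairing h q₀ r₀ p := by
    intro p
    have h1 : φ.pairing h q r p = φ.pairing h (q₀ + (q - q₀)) (r₀ + (r - r₀)) p := by
      rw [add_sub_cancel, add_sub_cancel]
    rw [h1, pairing_add_left, pairing_add_right, pairing_add_right,
      isInvariant_isotypic.pairing_eq_zero h hq hr',
      isInvariant_isotypic.orthogonal.pairing_eq_zero h hq'
        (by rwa [Submodule.orthogonal_orthogonal])]
    ring
  simp only [e]
  have hI : ∀ q r q' r' : SkewOp V,
      Integrable (fun p => φ.pairing h q r p * φ.pairing h q' r' p) (μ.prod μ) :=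
    fun q r q' r' => integrable_of_continuous_of_compactSpace _
      ((φ.continuous_pairing h _ _).mul (φ.continuous_pairing h _ _))
  rw [integral_add (hI _ _ _ _) (hI _ _ _ _),
    integral_pairing_mul_pairing_eq_zero μ hW h hq' hq, add_zero]

/-- The correlations of pairings on `dφ(𝔤_α)`. -/
theorem finrank_sq_mul_integral_pairing_mul_pairing (h : GroupLieAlgebra 𝓘(ℝ, E) G)
    (a r a' r' : φ.idealSpace α) :
    (finrank ℝ (φ.idealSpace α) : ℝ) ^ 2 *
      ∫ p, φ.pairing h a r p * φ.pairing h a' r' p ∂(μ.prod μ) =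
    ⟪a, a'⟫_ℝ * ⟪r, r'⟫_ℝ *
      LinearMap.trace ℝ _ (LinearMap.adjoint (φ.adIdeal α h) ∘ₗ φ.adIdeal α h) := by
  let mv : G → φ.idealSpace α → φ.idealSpace α := fun k w =>
    ⟨φ.conjRep k w, isInvariant_idealSpace k _ w.2⟩
  have h1 : ∀ k, (finrank ℝ (φ.idealSpace α) : ℝ) *
      ⟪⁅φ.dφ h, φ.conjRep k r⁆, φ.avgOp μ a a' ⁅φ.dφ h, φ.conjRep k r'⁆⟫_ℝ =
      ⟪a, a'⟫_ℝ * ⟪φ.adIdeal α h (mv k r), φ.adIdeal α h (mv k r')⟫_ℝ := by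
    intro k
    rw [inner_avgOp, ← finrank_mul_integral_inner_mul_inner μ]
    rfl
  let e := stdOrthonormalBasis ℝ (φ.idealSpace α)
  -- By skewness, ad H moves from the orbit vectors to a fixed basis, with two signs cancelling. The
  -- integral over k then has the form of Schur orthogonality, and the sum over i becomes the trace.
  have h2 : ∀ k, ⟪φ.adIdeal α h (mv k r), φ.adIdeal α h (mv k r')⟫_ℝ =
      ∑ i, ⟪(φ.adIdeal α h (e i) : SkewOp V), φ.conjRep k r⟫_ℝ *
        ⟪(φ.adIdeal α h (e i) : SkewOp V), φ.conjRep k r'⟫_ℝ := by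
    intro k
    rw [← e.sum_inner_mul_inner]
    refine Finset.sum_congr rfl fun i => fun _ => ?_
    have h3 : ∀ w : φ.idealSpace α, ⟪φ.adIdeal α h w, e i⟫_ℝ = -⟪w, φ.adIdeal α h (e i)⟫_ℝ :=
      fun w => inner_lie_left _ _ _
    rw [real_inner_comm (φ.adIdeal α h (mv k r')), h3, h3, neg_mul_neg,
      real_inner_comm _ (mv k r), real_inner_comm _ (mv k r')]
    rfl
  rw [integral_pairing_mul_pairing, pow_two, mul_assoc, ← integral_const_mul]
  simp only [h1, h2]
  rw [integral_const_mul, integral_finsetSum]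
  · rw [mul_left_comm, Finset.mul_sum]
    simp only [finrank_mul_integral_inner_mul_inner μ]
    rw [← Finset.mul_sum, mul_assoc, LinearMap.trace_eq_sum_inner _ e]
    congr 2
    refine Finset.sum_congr rfl fun i _ => ?_
    rw [LinearMap.comp_apply, LinearMap.adjoint_inner_right]
  · intro i _
    exact integrable_of_continuous_of_compactSpace μ
      ((continuous_const.inner (φ.continuous_conjRep _)).mul
        (continuous_const.inner (φ.continuous_conjRep _)))

theorem Param.pairing_eq {C : Submodule ℝ (SkewOp V)} (p : φ.Param α C)
    (h : GroupLieAlgebra 𝓘(ℝ, E) G) (a r : φ.idealSpace α) (x : G × G) :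
    φ.pairing h (p.σ a) (p.σ r) x = φ.pairing h a r x := by
  let mv : G → φ.idealSpace α → φ.idealSpace α := fun k w =>
    ⟨φ.conjRep k w, isInvariant_idealSpace k _ w.2⟩
  rw [pairing, ← p.equivariant x.1 a (mv x.1 a) rfl, ← p.equivariant x.2 r (mv x.2 r) rfl,
    ← p.σ_adIdeal]
  exact p.inner_map_map _ _

theorem pairing_sum {ι : Type*} [Fintype ι] (h : GroupLieAlgebra 𝓘(ℝ, E) G)
    (q r : ι → SkewOp V) (p : G × G) :
    φ.pairing h (∑ i, q i) (∑ j, r j) p = ∑ i, ∑ j, φ.pairing h (q i) (r j) p := by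
  simp only [pairing, map_sum, ← ad_apply, sum_inner, inner_sum]

/-- Distinct components are orthogonal and stable under brackets with H, so only diagonal terms
survive. Squaring this sum creates the cross terms between components. -/
theorem pairing_isotypicPart (hW : φ.IsComplementDecomposition W)
    (h : GroupLieAlgebra 𝓘(ℝ, E) G) (q r : SkewOp V) (x : G × G) :
    φ.pairing h (isotypicPart φ α W q) (isotypicPart φ α W r) x =
      ∑ i, φ.pairing h ((componentParam φ α W i).coord q) ((componentParam φ α W i).coord r) x := by
  rw [isotypicPart, isotypicPart, pairing_sum]
  refine Finset.sum_congr rfl fun i _ => ?_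
  rw [Finset.sum_eq_single_of_mem i (Finset.mem_univ i), Param.pairing_eq]
  intro j _ hj
  exact (isInvariant_component i).pairing_eq_zero h (Subtype.mem _)
    (component_orthogonal hW hj (Subtype.mem _)) x

theorem finrank_sq_mul_integral_isotypicPart (hW : φ.IsComplementDecomposition W)
    (h : GroupLieAlgebra 𝓘(ℝ, E) G) (O ρ : Observable V) :
    (finrank ℝ (φ.idealSpace α) : ℝ) ^ 2 *
      ∫ p, φ.pairing h (isotypicPart φ α W (ofObs O)) (isotypicPart φ α W (ofObs ρ)) p *
        φ.pairing h (isotypicPart φ α W (ofObs O)) (isotypicPart φ α W (ofObs ρ)) p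
          ∂(μ.prod μ) =
    (∑ i, ∑ j, φ.corrFrob (component W α i) (component W α j) O ρ) *
      LinearMap.trace ℝ _ (LinearMap.adjoint (φ.adIdeal α h) ∘ₗ φ.adIdeal α h) := by
  have hI : ∀ q r q' r' : SkewOp V,
      Integrable (fun p => φ.pairing h q r p * φ.pairing h q' r' p) (μ.prod μ) :=
    fun q r q' r' => integrable_of_continuous_of_compactSpace _
      ((φ.continuous_pairing h _ _).mul (φ.continuous_pairing h _ _))
  simp only [pairing_isotypicPart hW, Finset.sum_mul_sum]
  rw [integral_finsetSum _ fun i _ => integrable_finsetSum _ fun j _ => hI _ _ _ _,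
    Finset.mul_sum, Finset.sum_mul]
  refine Finset.sum_congr rfl fun i _ => ?_
  rw [integral_finsetSum _ fun j _ => hI _ _ _ _, Finset.mul_sum, Finset.sum_mul]
  refine Finset.sum_congr rfl fun j _ => ?_
  rw [finrank_sq_mul_integral_pairing_mul_pairing μ,
    (componentParam φ α W i).corrFrob_rep_eq (componentParam φ α W j)]

end Correlation

/-! ### The contribution of a simple ideal -/

section Contribution

variable {K : Type*} [Fintype K]

open Classical in
variable (φ) in
/-- The contribution of the simple ideal `𝔤_α` to the lower bound, without the dimension factor. -/
def contribution (W : K → Subrepresentation φ.conjRep)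
    (α : SimpleIdeal (GroupLieAlgebra 𝓘(ℝ, E) G)) (h : GroupLieAlgebra 𝓘(ℝ, E) G)
    (O ρ : Observable V) : ℝ :=
  φ.killingNormSq α (φ.dφ h) *
      compNormSq (φ.idealSpace α) O * compNormSq (φ.idealSpace α) ρ +
    ∑ κ ∈ isoIndices W (φ.idealSpace α),
      (compNormSq (W κ).toSubmodule O * compNormSq (W κ).toSubmodule ρ *
          φ.corrKill (W κ).toSubmodule (W κ).toSubmodule (φ.dφ h).toObs +
        ∑ κ' ∈ (isoIndices W (W κ).toSubmodule).erase κ,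
          φ.corrFrob (W κ).toSubmodule (W κ').toSubmodule O ρ *
            φ.corrKill (W κ).toSubmodule (W κ').toSubmodule (φ.dφ h).toObs +
        2 * (φ.corrFrob (W κ).toSubmodule (φ.idealSpace α) O ρ *
            φ.corrKill (W κ).toSubmodule (φ.idealSpace α) (φ.dφ h).toObs))

variable [ConnectedSpace G] {W : K → Subrepresentation φ.conjRep}

theorem isoIndices_eq {κ : K} (hκ : κ ∈ isoIndices W (φ.idealSpace α)) :
    isoIndices W (W κ).toSubmodule = isoIndices W (φ.idealSpace α) := by
  obtain ⟨e⟩ := mem_isoIndices.1 hκ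
  ext κ'
  rw [mem_isoIndices, mem_isoIndices]
  constructor
  · rintro ⟨f⟩
    exact ⟨e.trans f⟩
  · rintro ⟨f⟩
    exact ⟨(e.symm isInvariant_idealSpace).trans f⟩

theorem Param.corrFrob_comm {W₁ W₂ : Submodule ℝ (SkewOp V)} (p₁ : φ.Param α W₁)
    (p₂ : φ.Param α W₂) (B C : Observable V) :
    φ.corrFrob W₁ W₂ B C = φ.corrFrob W₂ W₁ B C := by
  rw [p₁.corrFrob_rep_eq p₂, p₂.corrFrob_rep_eq p₁, real_inner_comm,
    real_inner_comm (p₁.coord (ofObs C))]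

/-- All the factors (iH) equal one trace t. The two mixed sums, over (κ, α) and (α, κ), agree by
symmetry of (O, ρ), whence the factor 2. Diagonal pairs give the products of squared norms. -/
theorem contribution_eq (hα : φ.idealSpace α ≠ ⊥) (h : GroupLieAlgebra 𝓘(ℝ, E) G)
    (O ρ : Observable V) :
    φ.contribution W α h O ρ =
      (∑ i, ∑ j, φ.corrFrob (component W α i) (component W α j) O ρ) *
        LinearMap.trace ℝ _ (LinearMap.adjoint (φ.adIdeal α h) ∘ₗ φ.adIdeal α h) := by
  classical
  set t := LinearMap.trace ℝ _ (LinearMap.adjoint (φ.adIdeal α h) ∘ₗ φ.adIdeal α h)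
  set S := isoIndices W (φ.idealSpace α) with hS
  let p := componentParam φ α W
  have hdiag : ∀ {C : Submodule ℝ (SkewOp V)}, φ.Param α C →
      compNormSq C O * compNormSq C ρ = φ.corrFrob C C O ρ := fun p => by
    rw [p.corrFrob_rep_eq p, p.compNormSq_eq, p.compNormSq_eq]
  have h1 : ∀ κ ∈ S,
      (compNormSq (W κ).toSubmodule O * compNormSq (W κ).toSubmodule ρ *
          φ.corrKill (W κ).toSubmodule (W κ).toSubmodule (φ.dφ h).toObs +
        ∑ κ' ∈ (isoIndices W (W κ).toSubmodule).erase κ,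
          φ.corrFrob (W κ).toSubmodule (W κ').toSubmodule O ρ *
            φ.corrKill (W κ).toSubmodule (W κ').toSubmodule (φ.dφ h).toObs +
        2 * (φ.corrFrob (W κ).toSubmodule (φ.idealSpace α) O ρ *
            φ.corrKill (W κ).toSubmodule (φ.idealSpace α) (φ.dφ h).toObs)) =
      (φ.corrFrob (φ.idealSpace α) (W κ).toSubmodule O ρ +
        (φ.corrFrob (W κ).toSubmodule (φ.idealSpace α) O ρ +
        ∑ κ' ∈ S, φ.corrFrob (W κ).toSubmodule (W κ').toSubmodule O ρ)) * t := by
    intro κ hκ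
    let q : φ.Param α (W κ).toSubmodule := p (some ⟨κ, hκ⟩)
    have h2 : ∀ κ' ∈ S.erase κ, φ.corrFrob (W κ).toSubmodule (W κ').toSubmodule O ρ *
        φ.corrKill (W κ).toSubmodule (W κ').toSubmodule (φ.dφ h).toObs =
        φ.corrFrob (W κ).toSubmodule (W κ').toSubmodule O ρ * t := by
      intro κ' hκ'
      let q' : φ.Param α (W κ').toSubmodule := p (some ⟨κ', Finset.mem_of_mem_erase hκ'⟩)
      rw [q.corrKill_toObs q']
    rw [isoIndices_eq hκ, Finset.sum_congr rfl h2, ← Finset.sum_mul, hdiag q, q.corrKill_toObs q,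
      q.corrKill_toObs (Param.refl φ α), (Param.refl φ α).corrFrob_comm q,
      ← Finset.add_sum_erase S _ hκ]
    ring
  rw [contribution, Finset.sum_congr rfl h1, killingNormSq_dφ hα, mul_assoc,
    hdiag (Param.refl φ α), ← Finset.sum_mul, mul_comm, ← add_mul, Fintype.sum_option,
    Fintype.sum_option]
  congr 1
  simp only [Fintype.sum_option, component]
  rw [Finset.sum_add_distrib, Finset.sum_coe_sort S
    (fun κ => φ.corrFrob (φ.idealSpace α) (W κ).toSubmodule O ρ), add_assoc]
  congr 2
  rw [← Finset.sum_coe_sort S]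
  refine Finset.sum_congr rfl fun κ _ => ?_
  rw [← Finset.sum_coe_sort S]

/-- If dφ kills 𝔤_α, the components isomorphic to W_α are zero. The Killing norm then depends on a
choice, but it is multiplied by zero. -/
theorem contribution_eq_zero (hα : φ.idealSpace α = ⊥) (h : GroupLieAlgebra 𝓘(ℝ, E) G)
    (O ρ : Observable V) : φ.contribution W α h O ρ = 0 := by
  classical
  have hsub : Subsingleton (φ.idealSpace α) := by rw [hα]; infer_instance
  have hN : ∀ {C : Submodule ℝ (SkewOp V)}, φ.Param α C → compNormSq C O = 0 := fun p => by
    rw [p.compNormSq_eq, Subsingleton.elim (p.coord _) 0, inner_zero_left]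
  have hF : ∀ {C C' : Submodule ℝ (SkewOp V)}, φ.Param α C → φ.Param α C' →
      φ.corrFrob C C' O ρ = 0 := fun p p' => by
    rw [p.corrFrob_rep_eq p', Subsingleton.elim (p.coord (ofObs O)) 0, inner_zero_left, zero_mul]
  rw [contribution, hN (Param.refl φ α), mul_zero, zero_mul, zero_add]
  refine Finset.sum_eq_zero fun κ hκ => ?_
  let q : φ.Param α (W κ).toSubmodule := componentParam φ α W (some ⟨κ, hκ⟩)
  rw [hN q, hF q (Param.refl φ α), Finset.sum_eq_zero]
  · ring
  · intro κ' hκ'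
    rw [isoIndices_eq hκ] at hκ'
    let q' : φ.Param α (W κ').toSubmodule :=
      componentParam φ α W (some ⟨κ', Finset.mem_of_mem_erase hκ'⟩)
    rw [hF q q', zero_mul]

end Contribution

/-! ### The lower bound -/

theorem sum_contribution_le_gradVar [T2Space G] [CompactSpace G] [ConnectedSpace G]
    [MeasurableSpace G] [BorelSpace G] (μ : Measure G) [μ.IsMulLeftInvariant]
    [IsProbabilityMeasure μ] (h : GroupLieAlgebra 𝓘(ℝ, E) G) (O ρ : Observable V)
    {K : Type*} [Fintype K] {W : K → Subrepresentation φ.conjRep}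
    (hW : φ.IsComplementDecomposition W) :
    ∑ α : SimpleIdeal (GroupLieAlgebra 𝓘(ℝ, E) G),
      (1 / (α.dim : ℝ) ^ 2) * φ.contribution W α h O ρ ≤ φ.gradVar μ O ρ h := by
  have : IsTopologicalGroup G := topologicalGroup_of_lieGroup 𝓘(ℝ, E) ∞
  -- A compact manifold is second countable, so continuous functions on G × G are measurable for the
  -- product σ-algebra.
  have : SecondCountableTopology G := ChartedSpace.secondCountable_of_sigmaCompact E G
  rw [gradVar_eq]
  refine le_trans (Finset.sum_le_sum fun α _ => ?_) (sum_integral_mul_self_le (μ.prod μ)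
    (φ.continuous_pairing h (ofObs O) (ofObs ρ))
    (F := fun α => φ.pairing h (isotypicPart φ α W (ofObs O)) (isotypicPart φ α W (ofObs ρ)))
    (fun α => φ.continuous_pairing h _ _)
    (fun α => integral_pairing_mul_pairing_isotypicPart μ hW h _ _)
    (fun α β hαβ => integral_pairing_mul_pairing_eq_zero μ hW h (α := β)
      (isotypic_orthogonal hW hαβ (isotypicPart_mem _)) (isotypicPart_mem _) _ _))
  -- For W_α = 0 the dimension of 𝔤_α differs from that of its image, so this case is separate: the
  -- contribution is zero and the integral nonnegative.
  by_cases hα : φ.idealSpace α = ⊥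
  · rw [contribution_eq_zero hα, mul_zero]
    exact integral_nonneg fun x => mul_self_nonneg _
  · have hd : (α.dim : ℝ) ≠ 0 := by
      rw [← finrank_idealSpace hα, Nat.cast_ne_zero]
      exact fun h0 => hα (Submodule.finrank_eq_zero.1 h0)
    rw [contribution_eq hα, ← finrank_sq_mul_integral_isotypicPart μ hW, finrank_idealSpace hα]
    field_simp
    exact le_rfl

end UnitaryRep

end DLA

end

open DLA in
open Classical in
theorem mainTheorem10
    {E : Type*} [NormedAddCommGroup E] [NormedSpace ℝ E] [FiniteDimensional ℝ E]
    {G : Type*} [TopologicalSpace G] [T2Space G] [CompactSpace G] [ConnectedSpace G]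
    [ChartedSpace E G] [Group G] [LieGroup 𝓘(ℝ, E) ∞ G]
    [MeasurableSpace G] [BorelSpace G]
    (μ : Measure G) [μ.IsHaarMeasure] [IsProbabilityMeasure μ]
    {V : Type*} [NormedAddCommGroup V] [InnerProductSpace ℂ V] [FiniteDimensional ℂ V]
    (φ : UnitaryRep E G V)
    (h : GroupLieAlgebra 𝓘(ℝ, E) G)
    (O ρ : Observable V) (hρ : IsDensityOperator ρ)
    {K : Type*} [Fintype K] (W : K → Subrepresentation φ.conjRep)
    (hW : φ.IsComplementDecomposition W) :
    (∀ (α : SimpleIdeal (GroupLieAlgebra 𝓘(ℝ, E) G)),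
      ∀ W₁ ∈ UnitaryRep.dlaComponents W α, ∀ W₂ ∈ UnitaryRep.dlaComponents W α,
        φ.Iso W₁ W₂ ∧ ∀ e : φ.GIso W₂ W₁,
          (∀ B C, e.corrFrob B C = φ.corrFrob W₁ W₂ B C) ∧
          (∀ u v A, e.corrKill u v A = φ.corrKill W₁ W₂ A)) ∧
    ∑ α : SimpleIdeal (GroupLieAlgebra 𝓘(ℝ, E) G), (1 / (α.dim : ℝ) ^ 2) *
      (φ.killingNormSq α (φ.dφ h) *
          UnitaryRep.compNormSq (φ.idealSpace α) O * UnitaryRep.compNormSq (φ.idealSpace α) ρ +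
        ∑ κ ∈ UnitaryRep.isoIndices W (φ.idealSpace α),
          (UnitaryRep.compNormSq (W κ).toSubmodule O * UnitaryRep.compNormSq (W κ).toSubmodule ρ *
              φ.corrKill (W κ).toSubmodule (W κ).toSubmodule (φ.dφ h).toObs +
            ∑ κ' ∈ (UnitaryRep.isoIndices W (W κ).toSubmodule).erase κ,
              φ.corrFrob (W κ).toSubmodule (W κ').toSubmodule O ρ *
                φ.corrKill (W κ).toSubmodule (W κ').toSubmodule (φ.dφ h).toObs +
            2 * (φ.corrFrob (W κ).toSubmodule (φ.idealSpace α) O ρ *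
                φ.corrKill (W κ).toSubmodule (φ.idealSpace α) (φ.dφ h).toObs)))
      ≤ φ.gradVar μ O ρ h :=
  ⟨fun _ _ h₁ _ h₂ => UnitaryRep.iso_and_corr_eq_of_mem_dlaComponents h₁ h₂,
    UnitaryRep.sum_contribution_le_gradVar μ h O ρ hW⟩
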